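/- Let $A$ be a connected Nakayama algebra, that is, an Artin algebra (finitely generated as a module over a commutative Artinian ring $R$, via an algebra structure) which is nonzero, has no central idempotents except $0$ and $1$, and whose finitely generated indecomposable projective modules and finitely generated indecomposable injective modules are all uniserial. Let $S_1,\dots,S_n$ be a complete set of pairwise non-isomorphic simple $A$-modules and $P(S_j)$ the projective cover of $S_j$. The Cartan matrix $C_A=(c_{ij})$ is the $n\times n$ matrix whose entry $c_{ij}$ is the number of copies of $S_i$ in a composition series of $P(S_j)$. For a simple module $S$ put $\tilde\tau(S)=\tau(S)$ if $S$ is not projective, where $\tau=D\,\mathrm{Tr}$ is the Auslander–Reiten translation, and let $\tilde\tau(S)$ be the unique simple injective $A$-module (up to isomorphism) if $S$ is projective. The resolution quiver of $A$ has the vertices $S_1,\dots,S_n$ and exactly one arrow starting at each vertex $S$, from $S$ to $\tilde\tau(\operatorname{soc}P(S))$. A cycle in it is called black if no simple module on it has projective dimension equal to $1$. Let $b(A)$ be the number of black cycles in the resolution quiver, and let $\mathbf 1$ be the $n\times 1$ vector with all entries $1$. Then: 1. $b(A)\neq 0$ if and only if $$\operatorname{rank}\begin{pmatrix} C_A^T\\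 C_A\end{pmatrix}=\operatorname{rank}\begin{pmatrix} C_A^T&\mathbf 1\\ C_A&\mathbf 1\end{pmatrix}.$$ 2. If $b(A)\neq 0$, then $b(A)=n+1-\operatorname{rank}(C_A,\,C_A^T)$. -/

import Mathlib

universe u

/-! ### Injective envelopes -/

/-- `i : M → E` is an injective envelope: `E` is injective, `i` is injective, and the image of `i`
is an essential submodule of `E`. -/
def IsInjectiveEnvelope (R : Type u) [Ring R] {M E : Type u} [AddCommGroup M] [Module R M]
    [AddCommGroup E] [Module R E] (i : M →ₗ[R] E) : Prop :=
  Module.Injective R E ∧ Function.Injective i ∧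
    ∀ K : Submodule R E, K ⊓ LinearMap.range i = ⊥ → K = ⊥

/-- A module together with an injective envelope of it. -/
structure InjectiveEnvelope (R : Type u) [Ring R] (M : Type u) [AddCommGroup M] [Module R M] where
  carrier : Type u
  [instAddCommGroup : AddCommGroup carrier]
  [instModule : Module R carrier]
  ι : M →ₗ[R] carrier
  isInjectiveEnvelope : IsInjectiveEnvelope R ι

/-- Every module has an injective envelope. -/
theorem InjectiveEnvelope.nonempty (R : Type u) [Ring R] (M : Type u) [AddCommGroup M]
    [Module R M] : Nonempty (InjectiveEnvelope R M) := by
  obtain ⟨E, _, _, i, hE, hi⟩ : ∃ (E : Type u) (_ : AddCommGroup E) (_ : Module R E)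
      (i : M →ₗ[R] E), Module.Injective R E ∧ Function.Injective i := by
    let F : ModuleCat.{u} R := CategoryTheory.Injective.under (ModuleCat.of R M)
    have hF : CategoryTheory.Injective (ModuleCat.of R F) :=
      inferInstanceAs (CategoryTheory.Injective
        (CategoryTheory.Injective.under (ModuleCat.of R M)))
    refine ⟨F, inferInstance, inferInstance,
      (CategoryTheory.Injective.ι (ModuleCat.of R M)).hom, ?_, ?_⟩
    · exact Module.injective_module_of_injective_object R _
    · exact (ModuleCat.mono_iff_injective _).1 inferInstance
  set N₀ := LinearMap.range i with hN₀
  obtain ⟨N, hN₀N, hN⟩ := zorn_le_nonempty₀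
    {N : Submodule R E | N₀ ≤ N ∧ ∀ K ≤ N, K ⊓ N₀ = ⊥ → K = ⊥} (by
      intro c hc hchain y hy
      refine ⟨sSup c, ⟨(hc hy).1.trans (le_sSup hy), ?_⟩, fun z hz => le_sSup hz⟩
      intro K hK hKN
      rw [eq_bot_iff]
      intro x hx
      obtain ⟨N, hNc, hxN⟩ := (Submodule.mem_sSup_of_directed ⟨y, hy⟩ hchain.directedOn).1 (hK hx)
      have h1 : Submodule.span R {x} ≤ N := by simpa [Submodule.span_le] using hxN
      have h2 : Submodule.span R {x} ≤ K := by simpa [Submodule.span_le] using hx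
      have := (hc hNc).2 _ h1 (eq_bot_iff.2 ((inf_le_inf_right _ h2).trans hKN.le))
      simpa using this) N₀ ⟨le_rfl, fun K hK h => by rwa [inf_eq_left.2 hK] at h⟩
  obtain ⟨K, -, hK⟩ := zorn_le_nonempty₀ {K : Submodule R E | K ⊓ N = ⊥} (by
      intro c hc hchain y hy
      refine ⟨sSup c, ?_, fun z hz => le_sSup hz⟩
      rw [Set.mem_ofPred_eq, eq_bot_iff]
      rintro x ⟨hx, hxN⟩
      obtain ⟨L, hLc, hxL⟩ := (Submodule.mem_sSup_of_directed ⟨y, hy⟩ hchain.directedOn).1 hx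
      have : x ∈ L ⊓ N := ⟨hxL, hxN⟩
      rwa [show L ⊓ N = ⊥ from hc hLc] at this) ⊥ (by simp)
  obtain ⟨h, hh⟩ := hE.out (K.mkQ.comp N.subtype) (by
    rw [← LinearMap.ker_eq_bot, eq_bot_iff]
    intro x hx
    have h1 : (x : E) ∈ K := by simpa using hx
    have h2 : (x : E) ∈ K ⊓ N := ⟨h1, x.2⟩
    rw [show K ⊓ N = ⊥ from hK.prop] at h2
    simpa using h2) N.subtype
  have hle : LinearMap.range h ≤ N := by
    refine hN.le_of_ge ⟨?_, ?_⟩ ?_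
    · intro x hx
      exact ⟨_, hh ⟨x, hN₀N hx⟩⟩
    · intro L hL hLN₀
      have hLN : L ⊓ N = ⊥ := hN.prop.2 _ inf_le_right
        (eq_bot_iff.2 ((inf_le_inf_right _ inf_le_left).trans hLN₀.le))
      have h3 : L.comap (h.comp K.mkQ) ≤ K := by
        refine hK.le_of_ge ?_ ?_
        · rw [Set.mem_ofPred_eq, eq_bot_iff]
          rintro x ⟨hx, hxN⟩
          have h4 : h (K.mkQ x) = x := hh ⟨x, hxN⟩
          have h5 : x ∈ L ⊓ N := ⟨h4 ▸ (show h (K.mkQ x) ∈ L from hx), hxN⟩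
          rwa [hLN] at h5
        · intro x hx
          have : K.mkQ x = 0 := by simpa using hx
          simp [this]
      rw [eq_bot_iff]
      intro y hy
      obtain ⟨z, rfl⟩ := hL hy
      obtain ⟨e, rfl⟩ := K.mkQ_surjective z
      have h6 : e ∈ K := h3 hy
      have : K.mkQ e = 0 := by simpa using h6
      simp [this]
    · intro x hx
      exact ⟨_, hh ⟨x, hx⟩⟩
  refine ⟨⟨N, i.codRestrict N fun x => hN₀N ⟨x, rfl⟩, ⟨⟨?_⟩, ?_, ?_⟩⟩⟩
  · intro X Y _ _ _ _ f hf g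
    obtain ⟨k, hk⟩ := hE.out f hf (N.subtype.comp g)
    refine ⟨((h.comp K.mkQ).codRestrict N fun x => hle ⟨_, rfl⟩).comp k, fun x => ?_⟩
    ext
    have := hh (g x)
    simpa [hk] using this
  · intro x y hxy
    exact hi (congrArg Subtype.val hxy)
  · intro L hL
    have h7 : L.map N.subtype = ⊥ := by
      refine hN.prop.2 _ (Submodule.map_subtype_le _ _) ?_
      rw [eq_bot_iff]
      rintro x ⟨⟨y, hy, rfl⟩, ⟨m, hm⟩⟩
      have h8 : y ∈ L ⊓ LinearMap.range (i.codRestrict N fun x => hN₀N ⟨x, rfl⟩) :=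
        ⟨hy, m, Subtype.ext hm⟩
      rw [hL] at h8
      have h9 : y = 0 := by simpa using h8
      simp [h9]
    exact Submodule.map_injective_of_injective N.subtype_injective (by simpa using h7)

noncomputable section

/-- The injective envelope of `R / rad R`, for a commutative ring `R`. -/
def DualizingModule (R : Type u) [CommRing R] : Type u :=
  (Classical.choice (InjectiveEnvelope.nonempty R (R ⧸ Ring.jacobson R))).carrier

instance (R : Type u) [CommRing R] : AddCommGroup (DualizingModule R) :=
  (Classical.choice (InjectiveEnvelope.nonempty R (R ⧸ Ring.jacobson R))).instAddCommGroup

instance (R : Type u) [CommRing R] : Module R (DualizingModule R) :=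
  (Classical.choice (InjectiveEnvelope.nonempty R (R ⧸ Ring.jacobson R))).instModule

/-! ### The duality `D` and the transpose over an Artin `R`-algebra -/

/-- The usual dual `D X = Hom_R(X, J)` of a right `A`-module `X`, where `J` is the injective
envelope of `R / rad R`. -/
def ArtinDual (R A X : Type u) [CommRing R] [Ring A] [Algebra R A] [AddCommGroup X]
    [Module R X] [Module Aᵐᵒᵖ X] [IsScalarTower R Aᵐᵒᵖ X] : Type u :=
  X →ₗ[R] DualizingModule R

section ArtinDual

variable (R A X : Type u) [CommRing R] [Ring A] [Algebra R A] [AddCommGroup X]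
    [Module R X] [Module Aᵐᵒᵖ X] [IsScalarTower R Aᵐᵒᵖ X]

instance : AddCommGroup (ArtinDual R A X) :=
  inferInstanceAs (AddCommGroup (X →ₗ[R] DualizingModule R))

/-- `D X` is a left `A`-module through `(a • φ) x = φ (x · a)`. -/
instance : Module A (ArtinDual R A X) where
  smul a φ := LinearMap.comp (R₁ := R) (R₂ := R) (R₃ := R) φ
    (Algebra.lsmul R R X (MulOpposite.op a))
  one_smul φ := LinearMap.ext fun x => congrArg (show X →ₗ[R] DualizingModule R from φ)
    (one_smul Aᵐᵒᵖ x)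
  mul_smul a b φ := LinearMap.ext fun x => congrArg (show X →ₗ[R] DualizingModule R from φ)
    (mul_smul (MulOpposite.op b) (MulOpposite.op a) x)
  smul_zero _ := LinearMap.ext fun _ => rfl
  smul_add _ _ _ := LinearMap.ext fun _ => rfl
  add_smul a b φ := LinearMap.ext fun x =>
    (congrArg (show X →ₗ[R] DualizingModule R from φ)
      (add_smul (MulOpposite.op a) (MulOpposite.op b) x)).trans (map_add _ _ _)
  zero_smul φ := LinearMap.ext fun x =>
    (congrArg (show X →ₗ[R] DualizingModule R from φ) (zero_smul Aᵐᵒᵖ x)).trans (map_zero _)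

end ArtinDual

/-- For `f : P₁ → P₀` this is the cokernel of
`Hom_A(f, A) : Hom_A(P₀, A) → Hom_A(P₁, A)`, a right `A`-module. If `f` is the first map of a
minimal projective presentation of `M`, it is the transpose `Tr M`. -/
abbrev TransposeOf {A P₁ P₀ : Type u} [Ring A] [AddCommGroup P₁] [Module A P₁]
    [AddCommGroup P₀] [Module A P₀] (f : P₁ →ₗ[A] P₀) : Type u :=
  (P₁ →ₗ[A] A) ⧸ LinearMap.range (LinearMap.lcomp Aᵐᵒᵖ A f)

/-- `p : P → M` is a projective cover: `P` is projective, `p` is onto and its kernel is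
superfluous. -/
def IsProjectiveCover {A P M : Type u} [Ring A] [AddCommGroup P] [Module A P]
    [AddCommGroup M] [Module A M] (p : P →ₗ[A] M) : Prop :=
  Module.Projective A P ∧ Function.Surjective p ∧
    ∀ N : Submodule A P, N ⊔ LinearMap.ker p = ⊤ → N = ⊤

/-- `P₁ → P₀ → M → 0` is a minimal projective presentation of `M`. -/
def IsMinimalPresentation {A P₁ P₀ M : Type u} [Ring A] [AddCommGroup P₁] [Module A P₁]
    [AddCommGroup P₀] [Module A P₀] [AddCommGroup M] [Module A M]
    (f : P₁ →ₗ[A] P₀) (p : P₀ →ₗ[A] M) : Prop :=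
  IsProjectiveCover p ∧ ∃ hf : ∀ x, f x ∈ LinearMap.ker p,
    IsProjectiveCover (f.codRestrict (LinearMap.ker p) hf)

/-- `T ≅ τ M`, where `τ = D Tr` is the Auslander–Reiten translation. -/
def IsARTranslate (R : Type u) {A : Type u} [CommRing R] [Ring A] [Algebra R A]
    (M T : Type u) [AddCommGroup M] [Module A M] [AddCommGroup T] [Module A T] : Prop :=
  ∃ (P₁ P₀ : Type u) (_ : AddCommGroup P₁) (_ : Module A P₁) (_ : AddCommGroup P₀)
    (_ : Module A P₀) (f : P₁ →ₗ[A] P₀) (p : P₀ →ₗ[A] M),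
    IsMinimalPresentation f p ∧ Nonempty (T ≃ₗ[A] ArtinDual R A (TransposeOf f))

/-! ### Connected Nakayama algebras -/

/-- A nonzero ring whose only central idempotents are `0` and `1`. -/
def IsConnectedRing (A : Type u) [Ring A] : Prop :=
  Nontrivial A ∧ ∀ e : A, e * e = e → (∀ a, e * a = a * e) → e = 0 ∨ e = 1

/-- A nonzero module that is not a direct sum of two nonzero submodules. -/
def IsIndecomposableModule (A M : Type u) [Ring A] [AddCommGroup M] [Module A M] : Prop :=
  Nontrivial M ∧ ∀ N K : Submodule A M, IsCompl N K → N = ⊥ ∨ K = ⊥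

/-- A module whose submodules are totally ordered by inclusion. -/
def IsUniserialModule (A M : Type u) [Ring A] [AddCommGroup M] [Module A M] : Prop :=
  ∀ N K : Submodule A M, N ≤ K ∨ K ≤ N

/-- All finitely generated indecomposable projective modules and all finitely generated
indecomposable injective modules are uniserial. -/
def IsNakayama (A : Type u) [Ring A] : Prop :=
  ∀ (M : Type u) [AddCommGroup M] [Module A M], Module.Finite A M → IsIndecomposableModule A M →
    (Module.Projective A M ∨ Module.Injective A M) → IsUniserialModule A M

/-! ### Simple modules, the Cartan matrix and the resolution quiver -/

/-- `S` is a complete family of pairwise non-isomorphic simple `A`-modules. -/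
def IsCompleteSimpleFamily (A : Type u) [Ring A] {n : ℕ} (S : Fin n → Type u)
    [∀ i, AddCommGroup (S i)] [∀ i, Module A (S i)] : Prop :=
  (∀ i, IsSimpleModule A (S i)) ∧ (∀ i j, Nonempty (S i ≃ₗ[A] S j) → i = j) ∧
    ∀ (M : Type u) [AddCommGroup M] [Module A M], IsSimpleModule A M →
      ∃ i, Nonempty (M ≃ₗ[A] S i)

/-- The number of factors of the composition series `s` that are isomorphic to `S`. -/
def compositionCount {A M : Type u} [Ring A] [AddCommGroup M] [Module A M]
    (s : CompositionSeries (Submodule A M)) (S : Type u) [AddCommGroup S] [Module A S] : ℕ :=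
  Nat.card {k : Fin s.length //
    Nonempty ((s k.succ ⧸ (s k.castSucc).submoduleOf (s k.succ)) ≃ₗ[A] S)}

open Classical in
/-- The number of copies of `S` in a composition series of `M`, for `M` of finite length. -/
def compositionMultiplicity (A M S : Type u) [Ring A] [AddCommGroup M] [Module A M]
    [AddCommGroup S] [Module A S] : ℕ :=
  if h : ∃ s : CompositionSeries (Submodule A M), s.head = ⊥ ∧ s.last = ⊤ then
    compositionCount h.choose S
  else 0

/-- The Cartan matrix: the entry at `(i, j)` is the multiplicity of `S i` in the projective
cover `P j` of `S j`. -/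
def cartanMatrix (A : Type u) [Ring A] {n : ℕ} (S P : Fin n → Type u)
    [∀ i, AddCommGroup (S i)] [∀ i, Module A (S i)]
    [∀ i, AddCommGroup (P i)] [∀ i, Module A (P i)] : Matrix (Fin n) (Fin n) ℚ :=
  Matrix.of fun i j => (compositionMultiplicity A (P j) (S i) : ℚ)

/-- The socle of a module: the sum of its simple submodules. -/
def socle (A M : Type u) [Ring A] [AddCommGroup M] [Module A M] : Submodule A M :=
  sSup {N : Submodule A M | IsSimpleModule A N}

/-- `T ≅ τ̃ S` for simple modules `S` and `T`: if `S` is not projective then `T ≅ τ S`, and if `S`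
is projective then `T` is the simple injective module. -/
def IsModifiedTranslate (R : Type u) {A : Type u} [CommRing R] [Ring A] [Algebra R A]
    (S T : Type u) [AddCommGroup S] [Module A S] [AddCommGroup T] [Module A T] : Prop :=
  (¬ Module.Projective A S ∧ IsARTranslate R (A := A) S T) ∨
    (Module.Projective A S ∧ IsSimpleModule A T ∧ Module.Injective A T)

/-- There is an arrow `i → j` in the resolution quiver: `S j ≅ τ̃ (soc P i)`. -/
def ResolutionArrow (R A : Type u) [CommRing R] [Ring A] [Algebra R A] {n : ℕ}
    (S P : Fin n → Type u) [∀ i, AddCommGroup (S i)] [∀ i, Module A (S i)]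
    [∀ i, AddCommGroup (P i)] [∀ i, Module A (P i)] (i j : Fin n) : Prop :=
  IsModifiedTranslate R (A := A) (socle A (P i)) (S j)

/-- `C` is the vertex set of an oriented cycle of the quiver with arrows `arrow`. In the resolution
quiver, where each vertex has exactly one outgoing arrow, a cycle is determined by its vertices. -/
def IsCycleSet {V : Type} (arrow : V → V → Prop) (C : Set V) : Prop :=
  ∃ (m : ℕ) (_ : NeZero m) (x : ZMod m → V), Function.Injective x ∧
    (∀ k, arrow (x k) (x (k + 1))) ∧ Set.range x = C

/-- The number of black cycles in the resolution quiver: those cycles all of whose vertices are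
simple modules of projective dimension different from `1`. -/
def blackCycleNumber (R A : Type u) [CommRing R] [Ring A] [Algebra R A] {n : ℕ}
    (S P : Fin n → Type u) [∀ i, AddCommGroup (S i)] [∀ i, Module A (S i)]
    [∀ i, AddCommGroup (P i)] [∀ i, Module A (P i)] : ℕ :=
  Set.ncard {C : Set (Fin n) | IsCycleSet (ResolutionArrow R A S P) C ∧
    ∀ i ∈ C, CategoryTheory.projectiveDimension (ModuleCat.of A (S i)) ≠ 1}

end

/-! The algebra enters only through Kupisch data. Each `P i` is uniserial, so the top of its radical
gives at most one arrow out of `i` (`exists_radicalArrow`, `radicalArrow_right_unique`); uniserial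
injective hulls give at most one arrow into each vertex (`radicalArrow_left_unique`). Connectedness
makes these arrows extend to a transitive permutation `σ` (`exists_perm`). With `L i` the length of
`P i`, the factors of `P i` from the top are indexed by i, σ i, …, σ^(L i - 1) i, which determines
the Cartan matrix C. Since τ of a non-projective `S m` is `S (σ m)`, the resolution quiver is the
graph of f(i) = σ^(L i) i (`resolutionArrow_iff`). Finally L i ≤ L (σ i) + 1, with equality exactly
when `S i` has projective dimension 1, so a cycle of f is black when L i ≤ L (σ i) along it.

The rest is linear algebra. One step along `σ` changes C x by x (σ u) minus the sum of x over the
f-fibre of σ u (`mulVec_sub`), and, for x supported on the image of f, changes Cᵀ x by x j minus x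
(f j) or 0 (`transpose_mulVec_sub`). Hence C x and Cᵀ x are both constant exactly when x is
supported on the black cycles and constant on each (`mulVec_const`, `transpose_mulVec_const`,
`mem_blackSpace`). Evaluating zᵀ C w in two ways shows that the two constants agree
(`mulVec_eq_transpose_mulVec`).

The space of such x has dimension b(A). If b(A) ≠ 0, the common constant is a nonzero functional on
it: it can be scaled to 1, and its kernel, of dimension b(A) - 1, is the common kernel of C and Cᵀ,
so rank-nullity gives the formula. If b(A) = 0 the space is zero and C x = Cᵀ x = 1 has no solution.
Comparing ranks tests exactly this solvability. -/

/-! ### Kupisch data: the combinatorics of the resolution quiver and of the Cartan matrix -/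

/-- A transitive permutation together with a length function which drops by at most one along the
permutation: the combinatorial data of a connected Nakayama algebra. -/
structure IsKupisch {V : Type} (σ : Equiv.Perm V) (L : V → ℕ) : Prop where
  transitive : ∀ i j, ∃ t : ℕ, (σ ^ t) i = j
  pos : ∀ i, 1 ≤ L i
  le_succ : ∀ i, L i ≤ L (σ i) + 1

/-- The end point of the arrow of the resolution quiver that starts at `j`. -/
def kupischMap {V : Type} (σ : Equiv.Perm V) (L : V → ℕ) (j : V) : V := (σ ^ L j) j

/-- The Cartan matrix attached to Kupisch data. -/
def kupischMatrix {V : Type} [DecidableEq V] (σ : Equiv.Perm V) (L : V → ℕ) : Matrix V V ℚ :=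
  Matrix.of fun i j => ((((Finset.range (L j)).filter fun t => (σ ^ t) j = i).card : ℕ) : ℚ)

/-- The vertices on black cycles. -/
def blackVertices {V : Type} (σ : Equiv.Perm V) (L : V → ℕ) : Set V :=
  {j | j ∈ Function.periodicPts (kupischMap σ L) ∧
    ∀ k, L ((kupischMap σ L)^[k] j) ≤ L (σ ((kupischMap σ L)^[k] j))}

namespace IsKupisch

open Matrix

variable {V : Type} {σ : Equiv.Perm V} {L : V → ℕ}

/-- Along s ↦ σ^s j the map f lifts to s ↦ s + L (σ^s j) on ℤ, and `le_succ` is precisely the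
monotonicity of this lift. Fibres and image of f are read off from where the lift stays constant or
jumps. -/
theorem monotone_lift (h : IsKupisch σ L) (j : V) :
    Monotone fun s : ℤ => s + (L ((σ ^ s) j) : ℤ) := by
  refine monotone_int_of_le_succ fun s => ?_
  have h1 := h.le_succ ((σ ^ s) j)
  have h2 : (σ ^ (s + 1)) j = σ ((σ ^ s) j) := by
    rw [add_comm, _root_.zpow_add, zpow_one, Equiv.Perm.mul_apply]
  simp only [h2]
  omega

/-- A preimage of σ^t j lifts to an integer hitting `t` exactly, not merely modulo the period: go
back `L w` steps from `t`. -/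
theorem exists_lift {j w : V} {t : ℕ} (hw : kupischMap σ L w = (σ ^ t) j) :
    ∃ s : ℤ, (σ ^ s) j = w ∧ s + (L ((σ ^ s) j) : ℤ) = t := by
  have h1 : (σ ^ ((t : ℤ) - L w)) j = w := by
    have : (σ ^ (t : ℤ)) j = (σ ^ (L w : ℤ)) w := by
      simpa [kupischMap] using hw.symm
    rw [sub_eq_neg_add, _root_.zpow_add, Equiv.Perm.mul_apply, this,
      ← Equiv.Perm.mul_apply, ← _root_.zpow_add]
    simp
  exact ⟨_, h1, by rw [h1]; ring⟩

/-- The lift takes the values `L j` at 0 and `L (σ j) + 1` at 1; being monotone, it skips everything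
strictly between. -/
theorem notMem_range (h : IsKupisch σ L) {j : V} {t : ℕ} (h1 : L j < t) (h2 : t ≤ L (σ j)) :
    (σ ^ t) j ∉ Set.range (kupischMap σ L) := by
  rintro ⟨w, hw⟩
  obtain ⟨s, -, hs⟩ := exists_lift hw
  rcases le_or_gt s 0 with h0 | h0
  · have := h.monotone_lift j h0
    simp at this
    omega
  · have := h.monotone_lift j (show (1 : ℤ) ≤ s from h0)
    simp at this
    omega

/-- The condition `L j ≤ L (σ j)` says that the lift strictly increases right after j, so j is the
largest integer in its fibre of the lift. A fibre has only one such point. -/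
theorem injective_of_le (h : IsKupisch σ L) {j w : V} (hj : L j ≤ L (σ j)) (hw : L w ≤ L (σ w))
    (hjw : kupischMap σ L j = kupischMap σ L w) : j = w := by
  obtain ⟨s, hs, hs'⟩ := exists_lift (t := L j) hjw.symm
  rcases lt_trichotomy s 0 with h0 | h0 | h0
  · have h1 := h.monotone_lift j (show s + 1 ≤ 0 from h0)
    have h2 : (σ ^ (s + 1)) j = σ w := by
      rw [add_comm, _root_.zpow_add, zpow_one, Equiv.Perm.mul_apply, hs]
    simp only [h2] at h1
    rw [hs] at hs'
    simp at h1
    omega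
  · simpa [h0] using hs
  · have h1 := h.monotone_lift j (show 1 ≤ s from h0)
    simp at h1
    omega

theorem eq_of_forall_apply_eq (h : IsKupisch σ L) {y : V → ℚ} (hy : ∀ u, y (σ u) = y u)
    (i j : V) : y i = y j := by
  obtain ⟨t, rfl⟩ := h.transitive i j
  induction t with
  | zero => simp
  | succ t ih => rw [pow_succ', Equiv.Perm.mul_apply, hy, ← ih]

/-! ### Differences of C x and Cᵀ x along the permutation. -/

section Fintype

variable [Fintype V] [DecidableEq V]

theorem mulVec_apply (x : V → ℚ) (i : V) :
    (kupischMatrix σ L *ᵥ x) i =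
      ∑ j, (∑ t ∈ Finset.range (L j), if (σ ^ t) j = i then (1 : ℚ) else 0) * x j := by
  simp [mulVec, dotProduct, kupischMatrix]

theorem transpose_mulVec_apply (x : V → ℚ) (j : V) :
    ((kupischMatrix σ L)ᵀ *ᵥ x) j = ∑ t ∈ Finset.range (L j), x ((σ ^ t) j) := by
  have : ∀ i, kupischMatrix σ L i j * x i =
      ∑ t ∈ Finset.range (L j), if (σ ^ t) j = i then x i else 0 := by
    intro i
    simp [kupischMatrix, Finset.sum_ite]
  simp only [mulVec, dotProduct, transpose_apply, this]
  rw [Finset.sum_comm]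
  simp

/-- Column j of the matrix counts the path j, σ j, …, σ^(L j - 1) j. Shifting the path by `σ`
telescopes and leaves only its start j and the end point f(j). -/
theorem mulVec_sub (x : V → ℚ) (u : V) :
    (kupischMatrix σ L *ᵥ x) (σ u) - (kupischMatrix σ L *ᵥ x) u =
      x (σ u) - ∑ w, if kupischMap σ L w = σ u then x w else 0 := by
  have key : ∀ j, (∑ t ∈ Finset.range (L j), if (σ ^ t) j = σ u then (1 : ℚ) else 0) -
      (∑ t ∈ Finset.range (L j), if (σ ^ t) j = u then (1 : ℚ) else 0) =
      (if j = σ u then 1 else 0) - if kupischMap σ L j = σ u then 1 else 0 := by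
    intro j
    have h1 : ∀ t, (if (σ ^ t) j = u then (1 : ℚ) else 0) =
        if (σ ^ (t + 1)) j = σ u then (1 : ℚ) else 0 := by
      intro t
      rw [pow_succ', Equiv.Perm.mul_apply]
      simp
    simp only [h1]
    rw [← Finset.sum_sub_distrib,
      Finset.sum_range_sub' (fun t => if (σ ^ t) j = σ u then (1 : ℚ) else 0)]
    rfl
  rw [mulVec_apply, mulVec_apply, ← Finset.sum_sub_distrib]
  simp only [← sub_mul, key]
  simp [sub_mul, Finset.sum_sub_distrib]

/-- The paths from j and σ j differ by the initial j and by the terms with exponents from `L j` to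
`L (σ j)`. Among the latter only the first, f(j), can lie in the image of f, so `hx` kills the
others; the range is empty when L j = L (σ j) + 1. -/
theorem transpose_mulVec_sub (h : IsKupisch σ L) (x : V → ℚ)
    (hx : ∀ v, v ∉ Set.range (kupischMap σ L) → x v = 0) (j : V) :
    ((kupischMatrix σ L)ᵀ *ᵥ x) j - ((kupischMatrix σ L)ᵀ *ᵥ x) (σ j) =
      x j - if L j ≤ L (σ j) then x (kupischMap σ L j) else 0 := by
  rw [transpose_mulVec_apply, transpose_mulVec_apply]
  have h1 : ∀ t, (σ ^ t) (σ j) = (σ ^ (t + 1)) j := fun t => by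
    rw [pow_succ, Equiv.Perm.mul_apply]
  simp only [h1]
  have h2 := Finset.sum_range_succ' (fun t => x ((σ ^ t) j)) (L (σ j))
  simp only [pow_zero, Equiv.Perm.one_apply] at h2
  have h3 : ∑ t ∈ Finset.range (L (σ j)), x ((σ ^ (t + 1)) j) =
      (∑ t ∈ Finset.range (L (σ j) + 1), x ((σ ^ t) j)) - x j := by rw [h2]; ring
  rw [h3]
  split_ifs with hb
  · have h4 : ∀ t, L j + 1 ≤ t → t ≤ L (σ j) + 1 →
        ∑ s ∈ Finset.range t, x ((σ ^ s) j) =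
          (∑ s ∈ Finset.range (L j), x ((σ ^ s) j)) + x (kupischMap σ L j) := by
      intro t ht
      induction t, ht using Nat.le_induction with
      | base => intro _; rw [Finset.sum_range_succ]; rfl
      | succ t ht ih =>
        intro ht'
        rw [Finset.sum_range_succ, ih (by omega), hx _ (h.notMem_range ht (by omega)), add_zero]
    rw [h4 _ (by omega) le_rfl]
    ring
  · rw [show L (σ j) + 1 = L j by have := h.le_succ j; omega]
    ring

end Fintype

/-! ### Vectors constant on the black cycles. -/

theorem map_mem_blackVertices {j : V} (hj : j ∈ blackVertices σ L) :
    kupischMap σ L j ∈ blackVertices σ L := by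
  refine ⟨(Function.bijOn_periodicPts (f := kupischMap σ L)).mapsTo hj.1, fun k => ?_⟩
  have := hj.2 (k + 1)
  rwa [Function.iterate_succ_apply] at this

theorem iterate_mem_blackVertices {j : V} (hj : j ∈ blackVertices σ L) (k : ℕ) :
    (kupischMap σ L)^[k] j ∈ blackVertices σ L := by
  induction k with
  | zero => exact hj
  | succ k ih =>
    rw [Function.iterate_succ_apply']
    exact map_mem_blackVertices ih

theorem exists_map_eq_of_mem_blackVertices {j : V} (hj : j ∈ blackVertices σ L) :
    ∃ w ∈ blackVertices σ L, kupischMap σ L w = j := by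
  obtain ⟨m, hm, hp⟩ := hj.1
  refine ⟨(kupischMap σ L)^[m - 1] j, iterate_mem_blackVertices hj _, ?_⟩
  rw [← Function.iterate_succ_apply' (kupischMap σ L), Nat.succ_eq_add_one, Nat.sub_add_cancel hm]
  exact hp

/-- Functions supported on the black cycles and constant on each of them. -/
def blackSpace (σ : Equiv.Perm V) (L : V → ℕ) : Submodule ℚ (V → ℚ) where
  carrier := {x | (∀ j ∉ blackVertices σ L, x j = 0) ∧
    ∀ j ∈ blackVertices σ L, x (kupischMap σ L j) = x j}
  add_mem' {x y} hx hy := ⟨fun j hj => by simp [hx.1 j hj, hy.1 j hj],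
    fun j hj => by simp [hx.2 j hj, hy.2 j hj]⟩
  zero_mem' := ⟨fun _ _ => rfl, fun _ _ => rfl⟩
  smul_mem' c x hx := ⟨fun j hj => by simp [hx.1 j hj], fun j hj => by simp [hx.2 j hj]⟩

open Classical in
theorem indicator_mem_blackSpace :
    (fun j => if j ∈ blackVertices σ L then (1 : ℚ) else 0) ∈ blackSpace σ L :=
  ⟨fun j hj => if_neg hj, fun j hj => by
    simp only [if_pos hj, if_pos (map_mem_blackVertices hj)]⟩

section Fintype

variable [Fintype V] [DecidableEq V]

theorem mulVec_const (h : IsKupisch σ L) {x : V → ℚ} (hx : x ∈ blackSpace σ L) (i j : V) :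
    (kupischMatrix σ L *ᵥ x) i = (kupischMatrix σ L *ᵥ x) j := by
  refine h.eq_of_forall_apply_eq (fun u => ?_) i j
  rw [← sub_eq_zero, mulVec_sub, sub_eq_zero]
  by_cases hu : σ u ∈ blackVertices σ L
  · obtain ⟨w, hw, hwu⟩ := exists_map_eq_of_mem_blackVertices hu
    rw [Finset.sum_eq_single w]
    · rw [if_pos hwu, ← hwu, hx.2 w hw]
    · intro v _ hv
      split_ifs with hvu
      · by_contra h0
        have hvb : v ∈ blackVertices σ L := by
          by_contra hvb
          exact h0 (hx.1 v hvb)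
        exact hv (h.injective_of_le (hvb.2 0) (hw.2 0) (hvu.trans hwu.symm))
      · rfl
    · simp
  · rw [hx.1 _ hu, Finset.sum_eq_zero]
    intro v _
    split_ifs with hvu
    · exact hx.1 v fun hv => hu (hvu ▸ map_mem_blackVertices hv)
    · rfl

theorem transpose_mulVec_const (h : IsKupisch σ L) {x : V → ℚ} (hx : x ∈ blackSpace σ L)
    (i j : V) : ((kupischMatrix σ L)ᵀ *ᵥ x) i = ((kupischMatrix σ L)ᵀ *ᵥ x) j := by
  refine h.eq_of_forall_apply_eq (fun u => Eq.symm ?_) i j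
  rw [← sub_eq_zero, h.transpose_mulVec_sub, sub_eq_zero]
  · split_ifs with hb
    · by_cases hu : u ∈ blackVertices σ L
      · exact (hx.2 u hu).symm
      -- If f(u) were black it would also have a black preimage w, and `injective_of_le` would force
      -- u = w.
      · rw [hx.1 u hu, hx.1]
        intro hfu
        obtain ⟨w, hw, hwu⟩ := exists_map_eq_of_mem_blackVertices hfu
        exact hu (h.injective_of_le hb (hw.2 0) hwu.symm ▸ hw)
    · exact hx.1 u fun hu => hb (hu.2 0)
  · intro v hv
    refine hx.1 v fun hvb => hv ?_
    obtain ⟨w, -, hw⟩ := exists_map_eq_of_mem_blackVertices hvb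
    exact ⟨w, hw⟩

/-- Constancy of C x gives x v as a sum over the f-fibre of v, so x is supported on the image of f
and the formula for Cᵀ x applies. It shows that f preserves the support, that x is constant along f
there, and that `L j ≤ L (σ j)` on the support. -/
theorem mem_blackSpace (h : IsKupisch σ L) {x : V → ℚ}
    (h1 : ∀ i j, (kupischMatrix σ L *ᵥ x) i = (kupischMatrix σ L *ᵥ x) j)
    (h2 : ∀ i j, ((kupischMatrix σ L)ᵀ *ᵥ x) i = ((kupischMatrix σ L)ᵀ *ᵥ x) j) :
    x ∈ blackSpace σ L := by
  have e1 : ∀ v, x v = ∑ w, if kupischMap σ L w = v then x w else 0 := by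
    intro v
    obtain ⟨u, rfl⟩ := σ.surjective v
    rw [← sub_eq_zero, ← mulVec_sub, h1 _ u, sub_self]
  have e1' : ∀ v, x v ≠ 0 → ∃ w, kupischMap σ L w = v ∧ x w ≠ 0 := by
    intro v hv
    rw [e1] at hv
    obtain ⟨w, -, hw⟩ := Finset.exists_ne_zero_of_sum_ne_zero hv
    rw [ne_eq, ite_eq_right_iff, Classical.not_imp] at hw
    exact ⟨w, hw⟩
  have e2 : ∀ j, x j = if L j ≤ L (σ j) then x (kupischMap σ L j) else 0 := by
    intro j
    rw [← sub_eq_zero, ← h.transpose_mulVec_sub, h2 _ (σ j), sub_self]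
    intro v hv
    by_contra h0
    obtain ⟨w, hw, -⟩ := e1' v h0
    exact hv ⟨w, hw⟩
  have e3 : ∀ j, x j ≠ 0 → L j ≤ L (σ j) ∧ x (kupischMap σ L j) = x j := by
    intro j hj
    have := e2 j
    split_ifs at this with hb
    · exact ⟨hb, this.symm⟩
    · exact absurd this hj
  have e4 : ∀ j, x j ≠ 0 → ∀ k, x ((kupischMap σ L)^[k] j) ≠ 0 := by
    intro j hj k
    induction k with
    | zero => exact hj
    | succ k ih =>
      rw [Function.iterate_succ_apply', (e3 _ ih).2]
      exact ih
  refine ⟨fun j hj => ?_, fun j hj => ?_⟩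
  · by_contra h0
    refine hj ⟨?_, fun k => (e3 _ (e4 j h0 k)).1⟩
    -- On the finite support f is onto by `e1'`, hence injective, hence every point is periodic.
    let g : {j // x j ≠ 0} → {j // x j ≠ 0} := fun j =>
      ⟨kupischMap σ L j, by rw [(e3 _ j.2).2]; exact j.2⟩
    have hg : Function.Surjective g := fun v => by
      obtain ⟨w, hw, hw'⟩ := e1' v v.2
      exact ⟨⟨w, hw'⟩, Subtype.ext hw⟩
    obtain ⟨m, hm, hp⟩ := (Finite.injective_iff_surjective.2 hg).mem_periodicPts ⟨j, h0⟩
    refine ⟨m, hm, ?_⟩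
    have hsemi : Function.Semiconj Subtype.val g (kupischMap σ L) := fun _ => rfl
    have := (hsemi.iterate_right m) ⟨j, h0⟩
    rw [hp.eq] at this
    exact this.symm
  · have := e2 j
    rw [if_pos (show L j ≤ L (σ j) from hj.2 0)] at this
    exact this.symm

open Classical in
-- Let c(w) and c'(z) be the constants of C w and Cᵀ z. Computing zᵀ C w twice gives (∑ z) c(w) = (∑
-- w) c'(z). Taking z, w among x and the indicator y of the black vertices, and dividing by ∑ y > 0,
-- yields c(x) = c'(x).
theorem mulVec_eq_transpose_mulVec (h : IsKupisch σ L) {x : V → ℚ} (hx : x ∈ blackSpace σ L)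
    (i : V) : (kupischMatrix σ L *ᵥ x) i = ((kupischMatrix σ L)ᵀ *ᵥ x) i := by
  set y : V → ℚ := fun j => if j ∈ blackVertices σ L then (1 : ℚ) else 0 with hy
  have hyb : y ∈ blackSpace σ L := indicator_mem_blackSpace
  have key : ∀ z w : V → ℚ, z ∈ blackSpace σ L → w ∈ blackSpace σ L →
      (∑ j, z j) * (kupischMatrix σ L *ᵥ w) i = (∑ j, w j) * ((kupischMatrix σ L)ᵀ *ᵥ z) i := by
    intro z w hz hw
    have e : z ⬝ᵥ (kupischMatrix σ L *ᵥ w) = w ⬝ᵥ ((kupischMatrix σ L)ᵀ *ᵥ z) := by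
      rw [mulVec_transpose, dotProduct_mulVec, dotProduct_comm]
    simp only [dotProduct] at e
    rw [Finset.sum_mul, Finset.sum_mul]
    convert e using 1
    · exact Finset.sum_congr rfl fun j _ => by rw [h.mulVec_const hw i j]
    · exact Finset.sum_congr rfl fun j _ => by rw [h.transpose_mulVec_const hz i j]
  by_cases hB : (blackVertices σ L).Nonempty
  · have hpos : 0 < ∑ j, y j := by
      obtain ⟨b, hb⟩ := hB
      refine Finset.sum_pos' (fun j _ => ?_) ⟨b, Finset.mem_univ _, ?_⟩
      · simp only [hy]; split_ifs <;> norm_num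
      · simp [hy, hb]
    have h1 := key y x hyb hx
    have h2 := key x y hx hyb
    have h3 := mul_left_cancel₀ hpos.ne' (key y y hyb hyb)
    rw [← h3, h2] at h1
    exact mul_left_cancel₀ hpos.ne' h1
  · have : x = 0 := funext fun j => hx.1 j fun hj => hB ⟨j, hj⟩
    simp [this]

open Classical in
theorem exists_transpose_mulVec_pos (h : IsKupisch σ L) (hB : (blackVertices σ L).Nonempty) :
    ∃ x ∈ blackSpace σ L, ∀ i, 0 < ((kupischMatrix σ L)ᵀ *ᵥ x) i := by
  refine ⟨_, indicator_mem_blackSpace, fun i => ?_⟩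
  obtain ⟨b, hb⟩ := hB
  -- By constancy the value may be computed at a black vertex b, where the term t = 0 of the path is
  -- b itself.
  rw [h.transpose_mulVec_const indicator_mem_blackSpace i b, transpose_mulVec_apply]
  refine Finset.sum_pos' (fun t _ => ?_) ⟨0, Finset.mem_range.2 (h.pos b), ?_⟩
  · split_ifs <;> norm_num
  · simp [hb]

theorem exists_mulVec_eq_one_iff (h : IsKupisch σ L) [Nonempty V] :
    (∃ x, (kupischMatrix σ L)ᵀ *ᵥ x = 1 ∧ kupischMatrix σ L *ᵥ x = 1) ↔
      (blackVertices σ L).Nonempty := by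
  constructor
  · rintro ⟨x, h1, h2⟩
    have hx : x ∈ blackSpace σ L := h.mem_blackSpace (by simp [h2]) (by simp [h1])
    by_contra hB
    have h0 : x = 0 := funext fun j => hx.1 j fun hj => hB ⟨j, hj⟩
    obtain ⟨i⟩ := ‹Nonempty V›
    have := congrFun h1 i
    simp [h0] at this
  · intro hB
    obtain ⟨x, hx, hpos⟩ := h.exists_transpose_mulVec_pos hB
    obtain ⟨i⟩ := ‹Nonempty V›
    set c := ((kupischMatrix σ L)ᵀ *ᵥ x) i with hc
    have hc0 : c ≠ 0 := (hpos i).ne'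
    have h1 : ∀ j, ((kupischMatrix σ L)ᵀ *ᵥ x) j = c := fun j => h.transpose_mulVec_const hx j i
    refine ⟨c⁻¹ • x, ?_, ?_⟩
    · ext j
      simp [mulVec_smul, h1, inv_mul_cancel₀ hc0]
    · ext j
      simp [mulVec_smul, h.mulVec_eq_transpose_mulVec hx, h1, inv_mul_cancel₀ hc0]

/-- The common kernel is the hyperplane of `blackSpace` on which the common constant vanishes; one
coordinate of Cᵀ x suffices as the functional because both constants agree. -/
theorem finrank_ker_fromRows (h : IsKupisch σ L) (hB : (blackVertices σ L).Nonempty) :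
    Module.finrank ℚ (LinearMap.ker (fromRows (kupischMatrix σ L)ᵀ (kupischMatrix σ L)).mulVecLin)
      + 1 = Module.finrank ℚ (blackSpace σ L) := by
  obtain ⟨i, hi⟩ := id hB
  let φ : (V → ℚ) →ₗ[ℚ] ℚ := LinearMap.proj i ∘ₗ ((kupischMatrix σ L)ᵀ).mulVecLin
  have hker : LinearMap.ker (fromRows (kupischMatrix σ L)ᵀ (kupischMatrix σ L)).mulVecLin =
      (LinearMap.ker (φ ∘ₗ (blackSpace σ L).subtype)).map (blackSpace σ L).subtype := by
    ext x
    have hx0 : x ∈ LinearMap.ker (fromRows (kupischMatrix σ L)ᵀ (kupischMatrix σ L)).mulVecLin ↔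
        (kupischMatrix σ L)ᵀ *ᵥ x = 0 ∧ kupischMatrix σ L *ᵥ x = 0 := by
      rw [LinearMap.mem_ker, mulVecLin_apply, fromRows_mulVec]
      constructor
      · intro hx
        exact ⟨funext fun j => congrFun hx (Sum.inl j), funext fun j => congrFun hx (Sum.inr j)⟩
      · rintro ⟨h1, h2⟩
        rw [h1, h2]
        ext (j | j) <;> rfl
    rw [hx0]
    constructor
    · rintro ⟨h1, h2⟩
      refine ⟨⟨x, h.mem_blackSpace (by simp [h2]) (by simp [h1])⟩, ?_, rfl⟩
      exact congrFun h1 i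
    · rintro ⟨⟨x, hx⟩, hx', rfl⟩
      have h1 : ((kupischMatrix σ L)ᵀ *ᵥ x) i = 0 := hx'
      have h2 : (kupischMatrix σ L)ᵀ *ᵥ x = 0 := funext fun j => by
        rw [h.transpose_mulVec_const hx j i, h1]; rfl
      refine ⟨h2, funext fun j => ?_⟩
      rw [Submodule.subtype_apply, h.mulVec_eq_transpose_mulVec hx, h2]
  rw [hker, Submodule.finrank_map_subtype_eq]
  have hr := LinearMap.finrank_range_add_finrank_ker (φ ∘ₗ (blackSpace σ L).subtype)
  have hsurj : LinearMap.range (φ ∘ₗ (blackSpace σ L).subtype) = ⊤ := by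
    rw [LinearMap.range_eq_top]
    obtain ⟨x, hx, hpos⟩ := h.exists_transpose_mulVec_pos hB
    refine LinearMap.surjective (f := φ ∘ₗ (blackSpace σ L).subtype) fun h0 => ?_
    have := LinearMap.congr_fun h0 ⟨x, hx⟩
    exact (hpos i).ne' this
  rw [hsurj] at hr
  simp at hr
  omega

end Fintype

/-! ### Cycles as orbits, and the dimension of the space of black vectors. -/

/-- The vertex sets of black cycles. -/
def blackCycles (σ : Equiv.Perm V) (L : V → ℕ) : Set (Set V) :=
  {C | IsCycleSet (fun i j => j = kupischMap σ L i) C ∧ ∀ i ∈ C, L i ≤ L (σ i)}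

theorem eq_orbit_of_isCycleSet {f : V → V} {C : Set V} (hC : IsCycleSet (fun i j => j = f i) C)
    {j : V} (hj : j ∈ C) : C = Set.range fun k : ℕ => f^[k] j := by
  obtain ⟨m, _, x, -, hx, rfl⟩ := hC
  obtain ⟨a, rfl⟩ := hj
  have key : ∀ k : ℕ, x (a + k) = f^[k] (x a) := by
    intro k
    induction k with
    | zero => simp
    | succ k ih =>
      rw [Function.iterate_succ_apply', ← ih, ← hx]
      push_cast
      ring_nf
  ext v
  constructor
  · rintro ⟨b, rfl⟩
    refine ⟨(b - a).val, ?_⟩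
    simp only
    rw [← key, ZMod.natCast_zmod_val]
    congr 1
    ring
  · rintro ⟨k, rfl⟩
    exact ⟨a + k, key k⟩

theorem mem_periodicPts_of_isCycleSet {f : V → V} {C : Set V}
    (hC : IsCycleSet (fun i j => j = f i) C) {j : V} (hj : j ∈ C) :
    j ∈ Function.periodicPts f := by
  obtain ⟨m, hm, x, -, hx, rfl⟩ := hC
  obtain ⟨a, rfl⟩ := hj
  have key : ∀ k : ℕ, x (a + k) = f^[k] (x a) := by
    intro k
    induction k with
    | zero => simp
    | succ k ih =>
      rw [Function.iterate_succ_apply', ← ih, ← hx]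
      push_cast
      ring_nf
  refine ⟨m, Nat.pos_of_ne_zero hm.out, ?_⟩
  have := key m
  rw [CharP.cast_eq_zero, add_zero] at this
  exact this.symm

theorem isCycleSet_orbit {f : V → V} {j : V} (hj : j ∈ Function.periodicPts f) :
    IsCycleSet (fun i j => j = f i) (Set.range fun k : ℕ => f^[k] j) := by
  have hpos := Function.minimalPeriod_pos_of_mem_periodicPts hj
  set m := Function.minimalPeriod f j with hm
  have : NeZero m := ⟨hpos.ne'⟩
  have hmod : ∀ k, f^[k % m] j = f^[k] j := fun k => Function.iterate_mod_minimalPeriod_eq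
  refine ⟨m, this, fun k => f^[k.val] j, ?_, ?_, ?_⟩
  · intro a b hab
    have := (Function.iterate_eq_iterate_iff_of_lt_minimalPeriod
      (ZMod.val_lt a) (ZMod.val_lt b)).1 hab
    exact ZMod.val_injective m this
  · intro k
    simp only
    rw [ZMod.val_add, hmod, ← Function.iterate_succ_apply' f]
    -- For m = 1 the value of `1 : ZMod m` is 0, so the two exponents agree only modulo m.
    rw [ZMod.val_one_eq_one_mod]
    conv_lhs => rw [← hmod]
    rw [Nat.add_mod_mod, hmod]
  · ext v
    constructor
    · rintro ⟨a, rfl⟩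
      exact ⟨a.val, rfl⟩
    · rintro ⟨k, rfl⟩
      refine ⟨(k : ZMod m), ?_⟩
      simp only
      rw [ZMod.val_natCast, hmod]

theorem mem_blackVertices_of_mem {C : Set V} (hC : C ∈ blackCycles σ L) {j : V} (hj : j ∈ C) :
    j ∈ blackVertices σ L := by
  refine ⟨mem_periodicPts_of_isCycleSet hC.1 hj, fun k => hC.2 _ ?_⟩
  rw [eq_orbit_of_isCycleSet hC.1 hj]
  exact ⟨k, rfl⟩

theorem orbit_mem_blackCycles {j : V} (hj : j ∈ blackVertices σ L) :
    (Set.range fun k : ℕ => (kupischMap σ L)^[k] j) ∈ blackCycles σ L := by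
  refine ⟨isCycleSet_orbit hj.1, ?_⟩
  rintro _ ⟨k, rfl⟩
  exact hj.2 k

theorem nonempty_of_mem_blackCycles {C : Set V} (hC : C ∈ blackCycles σ L) : C.Nonempty := by
  obtain ⟨m, _, x, -, -, rfl⟩ := hC.1
  exact ⟨x 0, 0, rfl⟩

theorem blackCycles_nonempty_iff : (blackCycles σ L).Nonempty ↔ (blackVertices σ L).Nonempty := by
  constructor
  · rintro ⟨C, hC⟩
    obtain ⟨j, hj⟩ := nonempty_of_mem_blackCycles hC
    exact ⟨j, mem_blackVertices_of_mem hC hj⟩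
  · rintro ⟨j, hj⟩
    exact ⟨_, orbit_mem_blackCycles hj⟩

theorem apply_iterate_eq {x : V → ℚ} (hx : x ∈ blackSpace σ L) {j : V}
    (hj : j ∈ blackVertices σ L) (k : ℕ) : x ((kupischMap σ L)^[k] j) = x j := by
  induction k with
  | zero => rfl
  | succ k ih =>
    rw [Function.iterate_succ_apply', hx.2 _ (iterate_mem_blackVertices hj k), ih]

open Classical in
/-- Functions on the set of black cycles. -/
noncomputable def blackSpaceEquiv (σ : Equiv.Perm V) (L : V → ℕ) :
    blackSpace σ L ≃ₗ[ℚ] (blackCycles σ L → ℚ) where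
  -- Any vertex of the cycle would do, as x is constant on it.
  toFun x C := x.1 (nonempty_of_mem_blackCycles C.2).some
  map_add' _ _ := rfl
  map_smul' _ _ := rfl
  invFun y := ⟨fun j => if hj : j ∈ blackVertices σ L then y ⟨_, orbit_mem_blackCycles hj⟩ else 0,
    fun j hj => dif_neg hj, fun j hj => by
      simp only [dif_pos hj, dif_pos (map_mem_blackVertices hj)]
      congr 2
      have h1 := eq_orbit_of_isCycleSet (orbit_mem_blackCycles hj).1 (j := kupischMap σ L j)
        ⟨1, rfl⟩
      exact h1.symm⟩
  left_inv x := by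
    ext j
    simp only
    split_ifs with hj
    · have hs := (nonempty_of_mem_blackCycles (orbit_mem_blackCycles hj)).some_mem
      obtain ⟨k, hk⟩ := hs
      rw [← hk]
      exact apply_iterate_eq x.2 hj k
    · exact (x.2.1 j hj).symm
  right_inv y := by
    ext C
    have hs := (nonempty_of_mem_blackCycles C.2).some_mem
    simp only
    rw [dif_pos (mem_blackVertices_of_mem C.2 hs)]
    congr 1
    exact Subtype.ext (eq_orbit_of_isCycleSet C.2.1 hs).symm

theorem finrank_blackSpace [Finite V] :
    Module.finrank ℚ (blackSpace σ L) = (blackCycles σ L).ncard := by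
  classical
  have : Fintype (blackCycles σ L) := Fintype.ofFinite _
  rw [(blackSpaceEquiv σ L).finrank_eq, Module.finrank_fintype_fun_eq_card,
    Set.ncard_eq_toFinset_card', Set.toFinset_card]

end IsKupisch

/-! ### Solvability of a linear system as an equality of ranks. -/

namespace Matrix

theorem rank_eq_rank_of_range_eq_sup {m n : Type*} [Fintype m] [Fintype n]
    (M : Matrix m n ℚ) (N : Matrix m (n ⊕ Unit) ℚ) (b : m → ℚ)
    (hN : LinearMap.range N.mulVecLin = LinearMap.range M.mulVecLin ⊔ Submodule.span ℚ {b}) :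
    M.rank = N.rank ↔ ∃ x, M *ᵥ x = b := by
  have h1 : (∃ x, M *ᵥ x = b) ↔ b ∈ LinearMap.range M.mulVecLin := Iff.rfl
  rw [h1, rank, rank, hN]
  constructor
  · intro h
    have := Submodule.eq_of_le_of_finrank_eq
      (le_sup_left : LinearMap.range M.mulVecLin ≤ _ ⊔ Submodule.span ℚ {b}) h
    rw [this]
    exact Submodule.mem_sup_right (Submodule.mem_span_singleton_self b)
  · intro h
    rw [sup_eq_left.2]
    simpa [Submodule.span_le] using h

theorem rank_fromRows_eq_rank_fromBlocks_iff {m : Type*} [Fintype m]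
    (A B : Matrix m m ℚ) :
    (fromRows A B).rank = (fromBlocks A (of fun _ (_ : Unit) => 1) B
      (of fun _ (_ : Unit) => 1)).rank ↔ ∃ x, A *ᵥ x = 1 ∧ B *ᵥ x = 1 := by
  rw [rank_eq_rank_of_range_eq_sup _ _ 1]
  · refine exists_congr fun x => ?_
    rw [fromRows_mulVec]
    constructor
    · intro h
      exact ⟨funext fun j => congrFun h (Sum.inl j), funext fun j => congrFun h (Sum.inr j)⟩
    · rintro ⟨h1, h2⟩
      rw [h1, h2]
      ext (j | j) <;> rfl
  · ext y
    rw [Submodule.mem_sup]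
    have key : ∀ (x : m → ℚ) (c : ℚ),
        fromBlocks A (of fun _ (_ : Unit) => 1) B (of fun _ (_ : Unit) => 1) *ᵥ
          (Sum.elim x fun _ => c) = fromRows A B *ᵥ x + c • 1 := by
      intro x c
      rw [fromBlocks_mulVec, fromRows_mulVec]
      ext (j | j) <;> simp [mulVec, dotProduct, Function.comp_def]
    constructor
    · rintro ⟨x, rfl⟩
      refine ⟨_, ⟨x ∘ Sum.inl, rfl⟩, x (Sum.inr ()) • 1,
        Submodule.smul_mem _ _ (Submodule.mem_span_singleton_self _), ?_⟩
      rw [mulVecLin_apply, mulVecLin_apply, ← key]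
      congr 1
      ext (j | j) <;> rfl
    · rintro ⟨_, ⟨x, rfl⟩, z, hz, rfl⟩
      obtain ⟨c, rfl⟩ := Submodule.mem_span_singleton.1 hz
      exact ⟨_, key x c⟩

end Matrix

theorem IsKupisch.rank_statement {V : Type} [Fintype V] [DecidableEq V] [Nonempty V]
    {σ : Equiv.Perm V} {L : V → ℕ} (h : IsKupisch σ L) (C : Matrix V V ℚ)
    (hC : C = kupischMatrix σ L) (b : ℕ) (hb : b = (IsKupisch.blackCycles σ L).ncard) :
    (b ≠ 0 ↔ (Matrix.fromRows C.transpose C).rank =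
      (Matrix.fromBlocks C.transpose (Matrix.of fun _ (_ : Unit) => 1)
          C (Matrix.of fun _ (_ : Unit) => 1)).rank) ∧
    (b ≠ 0 → (b : ℤ) = (Fintype.card V : ℤ) + 1 - ((Matrix.fromCols C C.transpose).rank : ℤ)) := by
  subst hC
  have hb0 : b ≠ 0 ↔ (blackVertices σ L).Nonempty := by
    rw [hb, ← IsKupisch.blackCycles_nonempty_iff, ne_eq, Set.ncard_eq_zero, ← ne_eq,
      Set.nonempty_iff_ne_empty]
  refine ⟨?_, fun hne => ?_⟩
  · rw [hb0, Matrix.rank_fromRows_eq_rank_fromBlocks_iff, h.exists_mulVec_eq_one_iff]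
  · have h1 := h.finrank_ker_fromRows (hb0.1 hne)
    rw [IsKupisch.finrank_blackSpace, ← hb] at h1
    -- The row of blocks (C, Cᵀ) has the rank of its transpose, the column of blocks whose kernel is
    -- known.
    rw [← Matrix.rank_transpose, Matrix.transpose_fromCols, Matrix.transpose_transpose]
    have h2 := LinearMap.finrank_range_add_finrank_ker
      (Matrix.fromRows (kupischMatrix σ L).transpose (kupischMatrix σ L)).mulVecLin
    rw [Module.finrank_fintype_fun_eq_card] at h2
    rw [Matrix.rank]
    omega

/-! ### Duality over a commutative Artinian ring -/

section Dualizing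

variable (R : Type u) [CommRing R]

theorem DualizingModule.exists_envelope :
    ∃ i : (R ⧸ Ring.jacobson R) →ₗ[R] DualizingModule R, IsInjectiveEnvelope R i :=
  ⟨(Classical.choice (InjectiveEnvelope.nonempty R (R ⧸ Ring.jacobson R))).ι,
    (Classical.choice (InjectiveEnvelope.nonempty R (R ⧸ Ring.jacobson R))).isInjectiveEnvelope⟩

instance : Module.Injective R (DualizingModule R) :=
  (DualizingModule.exists_envelope R).choose_spec.1

variable [IsArtinianRing R]

instance isSemisimpleModule_quotient_jacobson : IsSemisimpleModule R (R ⧸ Ring.jacobson R) := by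
  have h : IsSemisimpleModule (R ⧸ Ring.jacobson R) (R ⧸ Ring.jacobson R) :=
    IsSemiprimaryRing.isSemisimpleRing
  let f : (R ⧸ Ring.jacobson R) →ₛₗ[Ideal.Quotient.mk (Ring.jacobson R)] (R ⧸ Ring.jacobson R) :=
    { toFun := id
      map_add' := fun _ _ => rfl
      map_smul' := fun r x => by
        rw [Algebra.smul_def]
        rfl }
  have : RingHomSurjective (Ideal.Quotient.mk (Ring.jacobson R)) :=
    ⟨Ideal.Quotient.mk_surjective⟩
  exact (LinearMap.isSemisimpleModule_iff_of_bijective f Function.bijective_id).2 h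

variable {R}

/-- Two isomorphic simple submodules of `R / rad R` coincide. -/
theorem exists_eq_of_hom_quotient_jacobson {S : Type u} [AddCommGroup S] [Module R S]
    (φ ψ : S →ₗ[R] (R ⧸ Ring.jacobson R)) (hφ : Function.Injective φ) (s : S) :
    ∃ t, φ t = ψ s := by
  obtain ⟨K, hK⟩ := exists_isCompl (LinearMap.range φ)
  set π := (LinearMap.range φ).projectionOnto K hK with hπ
  -- `R / rad R` is cyclic, so the projection onto the range of `φ` is multiplication by a scalar t.
  -- It fixes the range of `φ`, so t acts as the identity on S and hence also on the image of `ψ`.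
  obtain ⟨t, ht⟩ := Ideal.Quotient.mk_surjective (π 1 : R ⧸ Ring.jacobson R)
  have key : ∀ x, (π x : R ⧸ Ring.jacobson R) = t • x := by
    intro x
    obtain ⟨r, rfl⟩ := Ideal.Quotient.mk_surjective x
    have h1 : (Ideal.Quotient.mk (Ring.jacobson R) r) = r • (1 : R ⧸ Ring.jacobson R) := by
      rw [Algebra.smul_def, mul_one]; rfl
    rw [h1, map_smul, Submodule.coe_smul, ← ht, smul_comm, Algebra.smul_def t, mul_one]; rfl
  have h2 : t • s = s := by
    apply hφ
    rw [map_smul, ← key]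
    exact congrArg Subtype.val
      (Submodule.projectionOnto_apply_left hK ⟨φ s, LinearMap.mem_range_self φ s⟩)
  have h3 : ψ s ∈ LinearMap.range φ := by
    rw [← h2, map_smul, ← key]
    exact (π (ψ s)).2
  exact h3

/-- By essentiality a simple module can only map into the submodule `R / rad R` of the dualizing
module, where isomorphic simple submodules coincide. So Hom(S, J) is zero or simple. -/
theorem DualizingModule.exists_smul_eq {S : Type u} [AddCommGroup S] [Module R S]
    [IsSimpleModule R S] {φ : S →ₗ[R] DualizingModule R} (hφ : φ ≠ 0)
    (ψ : S →ₗ[R] DualizingModule R) : ∃ r : R, r • φ = ψ := by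
  obtain ⟨i, -, hi, hess⟩ := DualizingModule.exists_envelope R
  have lift : ∀ χ : S →ₗ[R] DualizingModule R, ∃ χ' : S →ₗ[R] (R ⧸ Ring.jacobson R),
      i ∘ₗ χ' = χ := by
    intro χ
    have hle : LinearMap.range χ ≤ LinearMap.range i := by
      by_cases h0 : χ = 0
      · simp [h0]
      have h1 : LinearMap.range χ ⊓ LinearMap.range i ≠ ⊥ := fun h =>
        h0 (LinearMap.range_eq_bot.1 (hess _ h))
      have h2 : (LinearMap.range i).comap χ ≠ ⊥ := fun h => h1 (by
        rw [inf_comm, ← Submodule.map_comap_eq_self (f := χ)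
          (q := LinearMap.range i ⊓ _) inf_le_right,
          Submodule.comap_inf, h]
        simp)
      have h3 : (LinearMap.range i).comap χ = ⊤ := (eq_bot_or_eq_top _).resolve_left h2
      rw [LinearMap.range_eq_map, Submodule.map_le_iff_le_comap, h3]
    let e := LinearEquiv.ofInjective i hi
    refine ⟨e.symm.toLinearMap ∘ₗ χ.codRestrict _ fun s => hle ⟨s, rfl⟩, ?_⟩
    ext s
    have := e.apply_symm_apply (χ.codRestrict (LinearMap.range i) (fun s => hle ⟨s, rfl⟩) s)
    exact congrArg Subtype.val this
  obtain ⟨φ', rfl⟩ := lift φ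
  obtain ⟨ψ', rfl⟩ := lift ψ
  have hφ' : φ' ≠ 0 := fun h => hφ (by simp [h])
  have hinj := LinearMap.injective_of_ne_zero hφ'
  obtain ⟨s, hs⟩ : ∃ s : S, s ≠ 0 := by
    have := IsSimpleModule.nontrivial R S
    exact exists_ne 0
  obtain ⟨t, ht⟩ := exists_eq_of_hom_quotient_jacobson φ' ψ' hinj s
  obtain ⟨r, rfl⟩ := IsSimpleModule.toSpanSingleton_surjective R hs t
  refine ⟨r, LinearMap.ext fun x => ?_⟩
  obtain ⟨r', rfl⟩ := IsSimpleModule.toSpanSingleton_surjective R hs x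
  simp only [LinearMap.toSpanSingleton_apply, LinearMap.smul_apply, LinearMap.comp_apply,
    map_smul] at ht ⊢
  rw [← ht, map_smul, smul_comm]

/-- Hom(-, J) is exact and each simple factor contributes at most 1. The inequality is all that the
double-dual argument for simple modules needs. -/
theorem DualizingModule.length_hom_le {X : Type u} [AddCommGroup X] [Module R X]
    (hX : IsFiniteLength R X) :
    Module.length R (X →ₗ[R] DualizingModule R) ≤ Module.length R X := by
  induction hX with
  | of_subsingleton =>
    rw [Module.length_eq_zero_iff.2]
    · exact zero_le
    · infer_instance
  | @of_simple_quotient M _ _ N _ hN ih =>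
    have h1 : Module.length R ((M ⧸ N) →ₗ[R] DualizingModule R) ≤ Module.length R (M ⧸ N) := by
      rw [Module.length_eq_one R (M ⧸ N)]
      by_cases h0 : Subsingleton ((M ⧸ N) →ₗ[R] DualizingModule R)
      · rw [Module.length_eq_zero]; exact zero_le
      · have : Nontrivial ((M ⧸ N) →ₗ[R] DualizingModule R) := not_subsingleton_iff_nontrivial.1 h0
        have : IsSimpleModule R ((M ⧸ N) →ₗ[R] DualizingModule R) := by
          rw [isSimpleModule_iff_toSpanSingleton_surjective]
          exact ⟨this, fun φ hφ ψ => DualizingModule.exists_smul_eq hφ ψ⟩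
        rw [Module.length_eq_one R ((M ⧸ N) →ₗ[R] DualizingModule R)]
    rw [Module.length_eq_add_of_exact (LinearMap.lcomp R (DualizingModule R) N.mkQ)
      (LinearMap.lcomp R (DualizingModule R) N.subtype),
      Module.length_eq_add_of_exact N.subtype N.mkQ N.subtype_injective N.mkQ_surjective
        (LinearMap.exact_subtype_mkQ N), add_comm]
    · exact add_le_add ih h1
    · exact fun φ ψ h => LinearMap.ext fun x => by
        obtain ⟨y, rfl⟩ := N.mkQ_surjective x
        exact LinearMap.congr_fun h y
    · intro φ
      obtain ⟨k, hk⟩ := Module.Injective.out N.subtype N.subtype_injective φ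
      exact ⟨k, LinearMap.ext hk⟩
    · intro φ
      constructor
      · intro h
        refine ⟨N.liftQ φ fun x hx => ?_, LinearMap.ext fun x => rfl⟩
        exact LinearMap.congr_fun h ⟨x, hx⟩
      · rintro ⟨ψ, rfl⟩
        ext x
        have : (Submodule.Quotient.mk (x : M) : M ⧸ N) = 0 := by simp
        simp [this]

/-- R x maps onto some R / m, which embeds into the semisimple `R / rad R` and hence into J;
injectivity of J extends the map to X. -/
theorem DualizingModule.exists_apply_ne_zero {X : Type u} [AddCommGroup X] [Module R X]
    {x : X} (hx : x ≠ 0) : ∃ φ : X →ₗ[R] DualizingModule R, φ x ≠ 0 := by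
  obtain ⟨i, -, hi, -⟩ := DualizingModule.exists_envelope R
  have hne : Ideal.torsionOf R X x ≠ ⊤ := fun h => hx ((Ideal.torsionOf_eq_top_iff R x).1 h)
  obtain ⟨m, hm, hle⟩ := Ideal.exists_le_maximal _ hne
  have hrad : Ring.jacobson R ≤ m := by
    rw [Ring.jacobson_eq_sInf_isMaximal]
    exact sInf_le hm
  let q : (R ⧸ Ring.jacobson R) →ₗ[R] R ⧸ m := Submodule.factor hrad
  obtain ⟨j, hj⟩ := IsSemisimpleModule.lifting_property q (Submodule.factor_surjective hrad)
    (LinearMap.id)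
  let e := Ideal.quotTorsionOfEquivSpanSingleton R X x
  let θ : (R ∙ x) →ₗ[R] DualizingModule R :=
    i ∘ₗ j ∘ₗ Submodule.factor hle ∘ₗ e.symm.toLinearMap
  obtain ⟨k, hk⟩ := Module.Injective.out (R ∙ x).subtype (R ∙ x).subtype_injective θ
  refine ⟨k, ?_⟩
  have h1 : k x = i (j (Ideal.Quotient.mk m 1)) := by
    rw [show x = (R ∙ x).subtype ⟨x, Submodule.mem_span_singleton_self x⟩ from rfl, hk]
    have : e.symm ⟨x, Submodule.mem_span_singleton_self x⟩ = Ideal.Quotient.mk _ 1 := by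
      rw [LinearEquiv.symm_apply_eq]
      ext
      exact (one_smul R x).symm
    simp only [θ, LinearMap.comp_apply, LinearEquiv.coe_coe, this]
    rfl
  rw [h1]
  intro h0
  have h2 := hi (h0.trans (map_zero i).symm)
  have h3 : q (j (Ideal.Quotient.mk m 1)) = 0 := by rw [h2, map_zero]
  have h4 : q (j (Ideal.Quotient.mk m 1)) = Ideal.Quotient.mk m 1 := LinearMap.congr_fun hj _
  rw [h4, map_one] at h3
  exact hm.ne_top (Ideal.Quotient.zero_eq_one_iff.1 h3.symm)

end Dualizing

/-! ### Duals of simple right modules. -/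

section ArtinDual

variable {R A X : Type u} [CommRing R] [Ring A] [Algebra R A] [AddCommGroup X]
    [Module R X] [Module Aᵐᵒᵖ X] [IsScalarTower R Aᵐᵒᵖ X]

noncomputable instance : Module R (ArtinDual R A X) :=
  inferInstanceAs (Module R (X →ₗ[R] DualizingModule R))

/-- The underlying `R`-linear map of an element of `D X`. -/
noncomputable def ArtinDual.toHom : ArtinDual R A X ≃ₗ[R] (X →ₗ[R] DualizingModule R) :=
  LinearEquiv.refl R _

theorem ArtinDual.toHom_smul (a : A) (φ : ArtinDual R A X) (x : X) :
    ArtinDual.toHom (a • φ) x = ArtinDual.toHom φ (MulOpposite.op a • x) := rfl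

instance : IsScalarTower R A (ArtinDual R A X) where
  smul_assoc r a φ := by
    apply ArtinDual.toHom.injective
    ext x
    rw [ArtinDual.toHom_smul, MulOpposite.op_smul, smul_assoc, map_smul (ArtinDual.toHom φ),
      map_smul ArtinDual.toHom, LinearMap.smul_apply, ArtinDual.toHom_smul]

variable [IsArtinianRing R]

/-- For a nonzero T ≤ D X the annihilator of T in X is a proper submodule, hence zero, so X embeds
into Hom(T, J). Then length X ≤ length T ≤ length D X ≤ length X forces T = D X. -/
theorem ArtinDual.isSimpleModule [IsSimpleModule Aᵐᵒᵖ X] [Module.Finite R X] :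
    IsSimpleModule A (ArtinDual R A X) := by
  have hnt : Nontrivial X := IsSimpleModule.nontrivial Aᵐᵒᵖ X
  have hfin : IsFiniteLength R X :=
    isFiniteLength_iff_isNoetherian_isArtinian.2 ⟨inferInstance, inferInstance⟩
  have hlen := DualizingModule.length_hom_le hfin
  have hD : IsFiniteLength R (ArtinDual R A X) := by
    rw [← Module.length_ne_top_iff]
    exact ne_top_of_le_ne_top (Module.length_ne_top_iff.2 hfin) hlen
  obtain ⟨hDn, hDa⟩ := isFiniteLength_iff_isNoetherian_isArtinian.1 hD
  have hDnt : Nontrivial (ArtinDual R A X) := by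
    obtain ⟨x, hx⟩ := exists_ne (0 : X)
    obtain ⟨φ, hφ⟩ := DualizingModule.exists_apply_ne_zero (R := R) hx
    exact ⟨ArtinDual.toHom.symm φ, 0, fun h => hφ (LinearMap.congr_fun h x)⟩
  rw [isSimpleModule_iff]
  refine { eq_bot_or_eq_top := fun T => ?_ }
  by_cases hT : T = ⊥
  · exact Or.inl hT
  right
  let perp : Submodule Aᵐᵒᵖ X :=
    { carrier := {x | ∀ φ ∈ T, ArtinDual.toHom φ x = 0}
      add_mem' := fun hx hy φ hφ => by rw [map_add, hx φ hφ, hy φ hφ, add_zero]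
      zero_mem' := fun φ _ => map_zero _
      smul_mem' := fun a x hx φ hφ => hx (a.unop • φ) (T.smul_mem _ hφ) }
  have hperp : perp = ⊥ := by
    refine (eq_bot_or_eq_top perp).resolve_right fun h => hT ?_
    rw [eq_bot_iff]
    intro φ hφ
    refine LinearMap.ext fun x => ?_
    have hx : x ∈ perp := h ▸ Submodule.mem_top
    exact hx φ hφ
  let T' : Submodule R (ArtinDual R A X) := T.restrictScalars R
  let ev : X →ₗ[R] (T' →ₗ[R] DualizingModule R) :=
    (LinearMap.lcomp R (DualizingModule R) (ArtinDual.toHom.toLinearMap ∘ₗ T'.subtype)) ∘ₗ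
      LinearMap.applyₗ
  have hev : Function.Injective ev := by
    rw [← LinearMap.ker_eq_bot, eq_bot_iff]
    intro x hx
    have : x ∈ perp := fun φ hφ => LinearMap.congr_fun (LinearMap.mem_ker.1 hx) ⟨φ, hφ⟩
    rw [hperp] at this
    exact this
  have h1 := Module.length_le_of_injective ev hev
  have h2 : Module.length R (T' →ₗ[R] DualizingModule R) ≤ Module.length R T' :=
    DualizingModule.length_hom_le
      (isFiniteLength_iff_isNoetherian_isArtinian.2 ⟨inferInstance, inferInstance⟩)
  have hT' : T' = ⊤ := by
    by_contra hne
    have := Submodule.length_lt hne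
    exact absurd (this.trans_le (hlen.trans (h1.trans h2))) (lt_irrefl _)
  rw [eq_top_iff]
  intro φ _
  have : φ ∈ T' := hT' ▸ Submodule.mem_top
  exact this

theorem ArtinDual.isNoetherian [Module.Finite R X] : IsNoetherian A (ArtinDual R A X) := by
  have hfin : IsFiniteLength R X :=
    isFiniteLength_iff_isNoetherian_isArtinian.2 ⟨inferInstance, inferInstance⟩
  have hlen := DualizingModule.length_hom_le hfin
  have hD : IsFiniteLength R (ArtinDual R A X) := by
    rw [← Module.length_ne_top_iff]
    exact ne_top_of_le_ne_top (Module.length_ne_top_iff.2 hfin) hlen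
  have := (isFiniteLength_iff_isNoetherian_isArtinian.1 hD).1
  exact isNoetherian_of_tower R this

end ArtinDual

/-! ### `D A` as an injective module containing every simple module. -/

section Cogenerator

variable {R A : Type u} [CommRing R] [Ring A] [Algebra R A]

/-- The `A`-linear map into `D A` attached to an `R`-linear map into the dualizing module. -/
noncomputable def ArtinDual.ofHom {Y : Type u} [AddCommGroup Y] [Module R Y] [Module A Y]
    [IsScalarTower R A Y] (k : Y →ₗ[R] DualizingModule R) : Y →ₗ[A] ArtinDual R A A where
  toFun y := ArtinDual.toHom.symm
    (k ∘ₗ ((LinearMap.toSpanSingleton A Y y).restrictScalars R))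
  map_add' y z := by
    apply ArtinDual.toHom.injective
    ext a
    simp
  map_smul' a y := by
    apply ArtinDual.toHom.injective
    ext b
    rw [RingHom.id_apply, ArtinDual.toHom_smul]
    simp [mul_smul]

theorem ArtinDual.ofHom_apply_one {Y : Type u} [AddCommGroup Y] [Module R Y] [Module A Y]
    [IsScalarTower R A Y] (k : Y →ₗ[R] DualizingModule R) (y : Y) :
    ArtinDual.toHom (ArtinDual.ofHom (A := A) k y) 1 = k y := by
  simp [ArtinDual.ofHom]

/-- Evaluation at 1 identifies A-linear maps Y → D A with R-linear maps Y → J, so extension problems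
reduce to the injectivity of J over R. -/
theorem ArtinDual.injective : Module.Injective A (ArtinDual R A A) where
  out X Y _ _ _ _ f hf g := by
    let : Module R X := Module.compHom X (algebraMap R A)
    let : Module R Y := Module.compHom Y (algebraMap R A)
    have : IsScalarTower R A X := ⟨fun r a x => by
      rw [Algebra.smul_def, mul_smul]; rfl⟩
    have : IsScalarTower R A Y := ⟨fun r a x => by
      rw [Algebra.smul_def, mul_smul]; rfl⟩
    let g' : X →ₗ[R] DualizingModule R :=
      LinearMap.applyₗ (1 : A) ∘ₗ ArtinDual.toHom.toLinearMap ∘ₗ g.restrictScalars R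
    obtain ⟨k, hk⟩ := Module.Injective.out (f.restrictScalars R) hf g'
    refine ⟨ArtinDual.ofHom k, fun x => ?_⟩
    apply ArtinDual.toHom.injective
    ext a
    have h1 := hk (a • x)
    have h2 : ArtinDual.toHom (g (a • x)) 1 = ArtinDual.toHom (g x) a := by
      rw [map_smul, ArtinDual.toHom_smul]
      simp
    have h3 : k (f (a • x)) = ArtinDual.toHom (g x) a := h1.trans h2
    rw [map_smul] at h3
    simpa [ArtinDual.ofHom] using h3

variable [IsArtinianRing R]

theorem exists_injective_hom_artinDual (S : Type u) [AddCommGroup S] [Module A S]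
    [IsSimpleModule A S] : ∃ j : S →ₗ[A] ArtinDual R A A, Function.Injective j := by
  let : Module R S := Module.compHom S (algebraMap R A)
  have : IsScalarTower R A S := ⟨fun r a x => by rw [Algebra.smul_def, mul_smul]; rfl⟩
  have := IsSimpleModule.nontrivial A S
  obtain ⟨s, hs⟩ := exists_ne (0 : S)
  obtain ⟨φ, hφ⟩ := DualizingModule.exists_apply_ne_zero (R := R) hs
  refine ⟨ArtinDual.ofHom φ, LinearMap.injective_of_ne_zero fun h => hφ ?_⟩
  rw [← ArtinDual.ofHom_apply_one (A := A), h]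
  rfl

end Cogenerator

/-- Every simple module embeds into a Noetherian uniserial injective module. -/
def HasUniserialHulls (A : Type u) [Ring A] : Prop :=
  ∀ (S : Type u) [AddCommGroup S] [Module A S], IsSimpleModule A S →
    ∃ (E : Type u) (_ : AddCommGroup E) (_ : Module A E) (ι : S →ₗ[A] E),
      Module.Injective A E ∧ IsUniserialModule A E ∧ IsNoetherian A E ∧ Function.Injective ι

/-- The injective envelope of S embeds into the Noetherian module D A, because S is essential in it.
It is finitely generated, and indecomposable since every nonzero submodule contains S; the Nakayama
hypothesis then applies. -/
theorem IsNakayama.hasUniserialHulls (R : Type u) {A : Type u} [CommRing R] [Ring A] [Algebra R A]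
    [IsArtinianRing R] [Module.Finite R A] (hNak : IsNakayama A) : HasUniserialHulls A := by
  intro S _ _ _
  obtain ⟨j, hj⟩ := exists_injective_hom_artinDual (R := R) (A := A) S
  obtain ⟨⟨E, ι, hE, hι, hess⟩⟩ := InjectiveEnvelope.nonempty A S
  have hinj : Module.Injective A (ArtinDual R A A) := ArtinDual.injective
  obtain ⟨k, hk⟩ := hinj.out ι hι j
  have hk_inj : Function.Injective k := by
    rw [← LinearMap.ker_eq_bot]
    apply hess
    rw [eq_bot_iff]
    rintro _ ⟨hx, ⟨s, rfl⟩⟩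
    have h1 : k (ι s) = 0 := hx
    rw [hk] at h1
    rw [hj (h1.trans (map_zero j).symm), map_zero]
    exact Submodule.zero_mem _
  have hDA : IsNoetherian A (ArtinDual R A A) := ArtinDual.isNoetherian
  have hEn : IsNoetherian A E := isNoetherian_of_injective k hk_inj
  have := IsSimpleModule.nontrivial A S
  have hsimple : IsSimpleModule A (LinearMap.range ι) :=
    IsSimpleModule.congr (LinearEquiv.ofInjective ι hι).symm
  have hatom : IsAtom (LinearMap.range ι) := isSimpleModule_iff_isAtom.1 hsimple
  refine ⟨E, _, _, ι, hE, hNak E inferInstance ⟨hι.nontrivial, fun N K hNK => ?_⟩ (Or.inr hE),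
    hEn, hι⟩
  by_contra! h
  have hle : ∀ N : Submodule A E, N ≠ ⊥ → LinearMap.range ι ≤ N := by
    intro N hN
    have h1 : N ⊓ LinearMap.range ι ≠ ⊥ := fun h => hN (hess _ h)
    exact inf_eq_right.1 ((hatom.le_iff.1 inf_le_right).resolve_left h1)
  exact hatom.1 (eq_bot_iff.2 ((le_inf (hle N h.1) (hle K h.2)).trans hNK.inf_eq_bot.le))

/-! ### Projective covers of simple modules -/

section Lifting

variable {A : Type u} [Ring A]

theorem Module.Injective.exists_comp_eq {E X Y : Type u} [AddCommGroup E] [Module A E]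
    [AddCommGroup X] [Module A X] [AddCommGroup Y] [Module A Y] (hE : Module.Injective A E)
    (g : X →ₗ[A] Y) (u : X →ₗ[A] E) (h : LinearMap.ker g ≤ LinearMap.ker u) :
    ∃ β : Y →ₗ[A] E, β ∘ₗ g = u := by
  obtain ⟨β, hβ⟩ := hE.out ((LinearMap.ker g).liftQ g le_rfl) (by
    rw [← LinearMap.ker_eq_bot]
    exact Submodule.ker_liftQ_eq_bot _ _ _ le_rfl) ((LinearMap.ker g).liftQ u h)
  exact ⟨β, LinearMap.ext fun x => hβ ((LinearMap.ker g).mkQ x)⟩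

theorem Module.Projective.exists_comp_eq {P Y E : Type u} [AddCommGroup P] [Module A P]
    [AddCommGroup Y] [Module A Y] [AddCommGroup E] [Module A E] (hP : Module.Projective A P)
    (β : Y →ₗ[A] E) (α : P →ₗ[A] E) (h : LinearMap.range α ≤ LinearMap.range β) :
    ∃ θ : P →ₗ[A] Y, β ∘ₗ θ = α := by
  obtain ⟨θ, hθ⟩ := Module.projective_lifting_property β.rangeRestrict
    (α.codRestrict (LinearMap.range β) fun x => h ⟨x, rfl⟩) β.surjective_rangeRestrict
  exact ⟨θ, LinearMap.ext fun x => congrArg Subtype.val (LinearMap.congr_fun hθ x)⟩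

end Lifting

namespace IsProjectiveCover

variable {A : Type u} [Ring A] {P S : Type u} [AddCommGroup P] [Module A P] [AddCommGroup S]
  [Module A S] {p : P →ₗ[A] S}

theorem comp_equiv (hp : IsProjectiveCover p) {T : Type u} [AddCommGroup T] [Module A T]
    (e : S ≃ₗ[A] T) : IsProjectiveCover (e.toLinearMap ∘ₗ p) :=
  ⟨hp.1, e.surjective.comp hp.2.1, fun N hN => hp.2.2 N (by rwa [LinearEquiv.ker_comp] at hN)⟩

variable [IsSimpleModule A S]

theorem isCoatom_ker (hp : IsProjectiveCover p) : IsCoatom (LinearMap.ker p) :=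
  LinearMap.isCoatom_ker_of_surjective hp.2.1

/-- P is local with radical `ker p`; nearly every surjectivity argument about projective covers
below rests on this. -/
theorem le_ker (hp : IsProjectiveCover p) {N : Submodule A P} (hN : N ≠ ⊤) :
    N ≤ LinearMap.ker p := by
  by_contra h
  refine hN (hp.2.2 N ?_)
  rw [sup_comm]
  exact hp.isCoatom_ker.2 _ (left_lt_sup.2 h)

theorem surjective_of_comp_ne_zero (hp : IsProjectiveCover p) {X : Type u} [AddCommGroup X]
    [Module A X] {f : X →ₗ[A] P} (hf : p ∘ₗ f ≠ 0) : Function.Surjective f := by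
  rw [← LinearMap.range_eq_top]
  by_contra h
  exact hf (LinearMap.ext fun x => hp.le_ker h ⟨x, rfl⟩)

theorem ker_eq (hp : IsProjectiveCover p) {T : Type u} [AddCommGroup T] [Module A T]
    [IsSimpleModule A T] {f : P →ₗ[A] T} (hf : f ≠ 0) : LinearMap.ker f = LinearMap.ker p := by
  have h1 : LinearMap.ker f ≠ ⊤ := fun h => hf (LinearMap.ker_eq_top.1 h)
  have h2 := LinearMap.isCoatom_ker_of_surjective (LinearMap.surjective_of_ne_zero hf)
  exact ((h2.le_iff.1 (hp.le_ker h1)).resolve_left hp.isCoatom_ker.1).symm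

theorem nonempty_equiv (hp : IsProjectiveCover p) {T : Type u} [AddCommGroup T] [Module A T]
    [IsSimpleModule A T] {f : P →ₗ[A] T} (hf : f ≠ 0) : Nonempty (S ≃ₗ[A] T) :=
  ⟨(p.quotKerEquivOfSurjective hp.2.1).symm ≪≫ₗ
    Submodule.quotEquivOfEq _ _ (hp.ker_eq hf).symm ≪≫ₗ
    f.quotKerEquivOfSurjective (LinearMap.surjective_of_ne_zero hf)⟩

theorem ne_zero (hp : IsProjectiveCover p) : p ≠ 0 := fun h =>
  hp.isCoatom_ker.1 (LinearMap.ker_eq_top.2 h)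

theorem exists_span_eq_top (hp : IsProjectiveCover p) : ∃ x : P, Submodule.span A {x} = ⊤ := by
  obtain ⟨x, hx⟩ : ∃ x, p x ≠ 0 := by
    by_contra! h
    exact hp.ne_zero (LinearMap.ext h)
  refine ⟨x, ?_⟩
  by_contra h
  exact hx (hp.le_ker h (Submodule.mem_span_singleton_self x))

theorem finite (hp : IsProjectiveCover p) : Module.Finite A P := by
  obtain ⟨x, hx⟩ := hp.exists_span_eq_top
  exact ⟨⟨{x}, by simpa using hx⟩⟩

theorem isUniserial (hp : IsProjectiveCover p) (hNak : IsNakayama A) : IsUniserialModule A P := by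
  refine hNak P hp.finite ⟨?_, fun N K hNK => ?_⟩ (Or.inl hp.1)
  · by_contra h
    rw [not_nontrivial_iff_subsingleton] at h
    exact hp.ne_zero (LinearMap.ext fun x => by rw [Subsingleton.elim x 0, map_zero]; rfl)
  · by_cases hN : N = ⊤
    · right
      have := hNK.inf_eq_bot
      rwa [hN, top_inf_eq] at this
    · left
      have h1 : K = ⊤ := by
        by_contra hK
        have := hNK.sup_eq_top
        exact hp.isCoatom_ker.1 (top_le_iff.1 (this ▸ sup_le (hp.le_ker hN) (hp.le_ker hK)))
      have := hNK.inf_eq_bot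
      rwa [h1, inf_top_eq] at this

/-- A map from `P` with nonzero composite with `c` and the same image as `c` is onto. -/
theorem surjective_of_range_comp (hp : IsProjectiveCover p) {X M : Type u} [AddCommGroup X]
    [Module A X] [AddCommGroup M] [Module A M] {c : P →ₗ[A] M} (hc : c ≠ 0) {θ : X →ₗ[A] P}
    (h : LinearMap.range c ≤ LinearMap.range (c ∘ₗ θ)) : Function.Surjective θ := by
  rw [← LinearMap.range_eq_top]
  by_contra hθ
  refine hc (LinearMap.ker_eq_top.1 ?_)
  by_contra hk
  refine hp.isCoatom_ker.1 (eq_top_iff.2 fun x _ => ?_)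
  obtain ⟨y, hy⟩ := h ⟨x, rfl⟩
  have h1 : x - θ y ∈ LinearMap.ker c := by
    rw [LinearMap.mem_ker, map_sub, sub_eq_zero]
    exact hy.symm
  have := add_mem (hp.le_ker hk h1) (hp.le_ker hθ ⟨y, rfl⟩)
  rwa [sub_add_cancel] at this

theorem projective_iff (hp : IsProjectiveCover p) :
    Module.Projective A S ↔ LinearMap.ker p = ⊥ := by
  constructor
  · intro h
    obtain ⟨s, hs⟩ := Module.projective_lifting_property p LinearMap.id hp.2.1
    have h1 : Function.Surjective s := hp.surjective_of_comp_ne_zero (f := s) (by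
      rw [hs]
      intro h0
      exact hp.ne_zero (LinearMap.ext fun x => LinearMap.congr_fun h0 (p x)))
    rw [eq_bot_iff]
    intro x hx
    obtain ⟨y, rfl⟩ := h1 x
    have h2 : p (s y) = y := LinearMap.congr_fun hs y
    have h3 : y = 0 := by rw [← h2]; exact hx
    simp [h3]
  · intro h
    have := hp.1
    exact Module.Projective.of_equiv
      (LinearEquiv.ofBijective p ⟨LinearMap.ker_eq_bot.1 h, hp.2.1⟩)

/-! ### Comparing maps out of `P₁` inside a uniserial injective module. -/

section Hull

variable {P₁ T E : Type u} [AddCommGroup P₁] [Module A P₁] [AddCommGroup T] [Module A T]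
  [AddCommGroup E] [Module A E] [IsSimpleModule A T] {q : P₁ →ₗ[A] T} {ι : T →ₗ[A] E}
  {f : P₁ →ₗ[A] P}

/-- A nonzero g has kernel inside the radical `ker q`, so `ι ∘ q` factors through its image and then
extends to Y. -/
theorem exists_extension (hq : IsProjectiveCover q) (hE : Module.Injective A E) {Y : Type u}
    [AddCommGroup Y] [Module A Y] {g : P₁ →ₗ[A] Y} (hg : g ≠ 0) (ι : T →ₗ[A] E) :
    ∃ β : Y →ₗ[A] E, β ∘ₗ g = ι ∘ₗ q := by
  refine hE.exists_comp_eq g _ ?_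
  have h1 : LinearMap.ker g ≠ ⊤ := fun h => hg (LinearMap.ker_eq_top.1 h)
  exact (hq.le_ker h1).trans (LinearMap.ker_le_ker_comp q ι)

theorem comp_ne_zero (hq : IsProjectiveCover q) (hι : Function.Injective ι) : ι ∘ₗ q ≠ 0 := by
  intro h
  exact hq.ne_zero (LinearMap.ext fun x => hι ((LinearMap.congr_fun h x).trans (map_zero ι).symm))

/-- A non-surjective map into a uniserial module factors through the radical of a projective cover,
up to a map with smaller image. -/
theorem exists_range_sub_lt (hp : IsProjectiveCover p) (hq : IsProjectiveCover q)
    (hE : Module.Injective A E) (hEu : IsUniserialModule A E) (hι : Function.Injective ι)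
    (hf : LinearMap.range f = LinearMap.ker p) (hf0 : f ≠ 0) {Q : Type u} [AddCommGroup Q]
    [Module A Q] (hQ : IsUniserialModule A Q) {g : P₁ →ₗ[A] Q} (hg : g ≠ 0)
    (hg' : LinearMap.range g ≠ ⊤) :
    ∃ θ : P →ₗ[A] Q, LinearMap.range (g - θ ∘ₗ f) < LinearMap.range g := by
  obtain ⟨α, hα⟩ := hq.exists_extension hE hf0 ι
  obtain ⟨β, hβ⟩ := hq.exists_extension hE hg ι
  have hne := hq.comp_ne_zero hι
  have h1 : ¬ LinearMap.range g ≤ LinearMap.ker β := fun h => hne (by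
    rw [← hβ, LinearMap.range_le_ker_iff.1 h])
  have h2 : LinearMap.ker β < LinearMap.range g :=
    lt_of_le_not_ge ((hQ _ _).resolve_left h1) h1
  -- Here range α ≤ range β is shown. Otherwise, by uniseriality of E, range β ≤ range α and the
  -- preimage of range β is only the radical range f; then Q = range g + ker β = range g. Lifting α
  -- through β gives θ with β (g - θ f) = 0, and ker β is smaller than range g.
  have h3 : (LinearMap.range β).comap α = ⊤ := by
    have hle : LinearMap.ker p ≤ (LinearMap.range β).comap α := by
      rw [← hf]
      rintro _ ⟨y, rfl⟩
      exact ⟨g y, (LinearMap.congr_fun hβ y).trans (LinearMap.congr_fun hα y).symm⟩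
    refine (hp.isCoatom_ker.le_iff.1 hle).resolve_right fun h => ?_
    rcases hEu (LinearMap.range α) (LinearMap.range β) with h4 | h4
    · refine hp.isCoatom_ker.1 ?_
      rw [← h, eq_top_iff]
      exact fun x _ => h4 ⟨x, rfl⟩
    · refine hg' (eq_top_iff.2 fun z _ => ?_)
      obtain ⟨x, hx⟩ := h4 ⟨z, rfl⟩
      have h5 : x ∈ LinearMap.range f := by
        rw [hf, ← h]
        exact ⟨z, hx.symm⟩
      obtain ⟨y, rfl⟩ := h5
      have h6 : z - g y ∈ LinearMap.ker β := by
        rw [LinearMap.mem_ker, map_sub, sub_eq_zero, ← hx]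
        exact (LinearMap.congr_fun hα y).trans (LinearMap.congr_fun hβ y).symm
      have := add_mem (h2.le h6) (LinearMap.mem_range_self g y)
      rwa [sub_add_cancel] at this
  obtain ⟨θ, hθ⟩ := hp.1.exists_comp_eq β α (by
    rintro _ ⟨x, rfl⟩
    have : x ∈ (LinearMap.range β).comap α := h3 ▸ Submodule.mem_top
    exact this)
  refine ⟨θ, lt_of_le_of_lt ?_ h2⟩
  rw [LinearMap.range_le_ker_iff, LinearMap.comp_sub, hβ, ← LinearMap.comp_assoc, hθ, hα, sub_self]

/-- A non-surjective map into a uniserial Artinian module factors through the radical of a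
projective cover. -/
theorem exists_comp_eq_of_range_ne_top (hp : IsProjectiveCover p) (hq : IsProjectiveCover q)
    (hE : Module.Injective A E) (hEu : IsUniserialModule A E) (hι : Function.Injective ι)
    (hf : LinearMap.range f = LinearMap.ker p) (hf0 : f ≠ 0) {Q : Type u} [AddCommGroup Q]
    [Module A Q] [IsArtinian A Q] (hQ : IsUniserialModule A Q) (g : P₁ →ₗ[A] Q)
    (hg : LinearMap.range g ≠ ⊤) : ∃ θ : P →ₗ[A] Q, θ ∘ₗ f = g := by
  induction hN : LinearMap.range g using WellFoundedLT.induction generalizing g with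
  | ind N ih =>
    by_cases hg0 : g = 0
    · exact ⟨0, by simp [hg0]⟩
    obtain ⟨θ, hθ⟩ := hp.exists_range_sub_lt hq hE hEu hι hf hf0 hQ hg0 hg
    obtain ⟨θ', hθ'⟩ := ih _ (hN ▸ hθ) (g - θ ∘ₗ f) (hθ.trans_le le_top).ne rfl
    exact ⟨θ' + θ, by rw [LinearMap.add_comp, hθ', sub_add_cancel]⟩

/-- The top of a module is determined by the top of its radical. -/
theorem nonempty_equiv_of_range_eq (hp : IsProjectiveCover p) (hq : IsProjectiveCover q)
    (hE : Module.Injective A E) (hEu : IsUniserialModule A E) (hι : Function.Injective ι)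
    (hf : LinearMap.range f = LinearMap.ker p) (hf0 : f ≠ 0) {P' S' : Type u} [AddCommGroup P']
    [Module A P'] [AddCommGroup S'] [Module A S'] [IsSimpleModule A S'] {p' : P' →ₗ[A] S'}
    (hp' : IsProjectiveCover p') {f' : P₁ →ₗ[A] P'} (hf' : LinearMap.range f' = LinearMap.ker p')
    (hf0' : f' ≠ 0) : Nonempty (S ≃ₗ[A] S') := by
  obtain ⟨α, hα⟩ := hq.exists_extension hE hf0 ι
  obtain ⟨α', hα'⟩ := hq.exists_extension hE hf0' ι
  have hne := hq.comp_ne_zero hι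
  -- The two covers play symmetric roles, so uniseriality of E allows range α ≤ range α'. If the
  -- lift θ of α through α' landed in the radical range f', then α and α ∘ f would have the same
  -- image and f would be onto.
  have aux : ∀ {P S P' S' : Type u} [AddCommGroup P] [Module A P] [AddCommGroup S] [Module A S]
      [AddCommGroup P'] [Module A P'] [AddCommGroup S'] [Module A S'] [IsSimpleModule A S]
      [IsSimpleModule A S'] {p : P →ₗ[A] S} {p' : P' →ₗ[A] S'} (_ : IsProjectiveCover p)
      (_ : IsProjectiveCover p') {f : P₁ →ₗ[A] P} {f' : P₁ →ₗ[A] P'}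
      (_ : LinearMap.range f = LinearMap.ker p) (_ : LinearMap.range f' = LinearMap.ker p')
      {α : P →ₗ[A] E} {α' : P' →ₗ[A] E} (_ : α ∘ₗ f = ι ∘ₗ q) (_ : α' ∘ₗ f' = ι ∘ₗ q)
      (_ : LinearMap.range α ≤ LinearMap.range α'), Nonempty (S ≃ₗ[A] S') := by
    intro P S P' S' _ _ _ _ _ _ _ _ _ _ p p' hp hp' f f' hf hf' α α' hα hα' hle
    obtain ⟨θ, hθ⟩ := hp.1.exists_comp_eq α' α hle
    refine hp.nonempty_equiv (f := p' ∘ₗ θ) fun h0 => ?_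
    have h1 : LinearMap.range f = ⊤ := by
      rw [LinearMap.range_eq_top]
      refine hp.surjective_of_range_comp (c := α) (fun h => hne (by rw [← hα, h]; simp)) ?_
      rintro _ ⟨x, rfl⟩
      have hx : θ x ∈ LinearMap.ker p' := LinearMap.congr_fun h0 x
      rw [← hf'] at hx
      obtain ⟨y, hy⟩ := hx
      refine ⟨y, ?_⟩
      rw [hα, ← hα', LinearMap.comp_apply, hy, ← LinearMap.comp_apply, hθ]
    exact hp.isCoatom_ker.1 (hf ▸ h1)
  rcases hEu (LinearMap.range α) (LinearMap.range α') with h | h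
  · exact aux hp hp' hf hf' hα hα' h
  · obtain ⟨e⟩ := aux hp' hp hf' hf hα' hα h
    exact ⟨e.symm⟩

/-- If the top of the radical of `P` is `T`, then `T` is not injective. -/
theorem not_injective (hp : IsProjectiveCover p) (hq : IsProjectiveCover q)
    (hf : LinearMap.range f = LinearMap.ker p) (hf0 : f ≠ 0) : ¬ Module.Injective A T := by
  intro hT
  obtain ⟨β, hβ⟩ := hq.exists_extension hT hf0 LinearMap.id
  rw [LinearMap.id_comp] at hβ
  have hβ0 : β ≠ 0 := fun h => hq.ne_zero (by rw [← hβ, h]; simp)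
  refine hq.ne_zero ?_
  rw [← hβ, ← LinearMap.range_le_ker_iff, hf, hp.ker_eq hβ0]

end Hull

/-- A simple quotient of the local module P has kernel `ker p`; applied to P → N → N / N', this
names the factor and presents N' as the image of the radical. It is the induction step for
descending a composition series. -/
theorem quotient_equiv_and_map_ker (hp : IsProjectiveCover p) {M : Type u} [AddCommGroup M]
    [Module A M] {N' N : Submodule A M} (h : N' ⋖ N) {θ : P →ₗ[A] M}
    (hθ : LinearMap.range θ = N) :
    Nonempty ((N ⧸ N'.submoduleOf N) ≃ₗ[A] S) ∧ (LinearMap.ker p).map θ = N' := by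
  have hs : IsSimpleModule A (N ⧸ N'.submoduleOf N) := (covBy_iff_quot_is_simple h.le).1 h
  let θ' : P →ₗ[A] N := θ.codRestrict N fun x => hθ ▸ ⟨x, rfl⟩
  have hθ's : Function.Surjective θ' := by
    rintro ⟨y, hy⟩
    rw [← hθ] at hy
    obtain ⟨x, rfl⟩ := hy
    exact ⟨x, rfl⟩
  let g : P →ₗ[A] (N ⧸ N'.submoduleOf N) := (N'.submoduleOf N).mkQ ∘ₗ θ'
  have hgs : Function.Surjective g := (Submodule.mkQ_surjective _).comp hθ's
  have hg0 : g ≠ 0 := by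
    intro h0
    have := IsSimpleModule.nontrivial A (N ⧸ N'.submoduleOf N)
    obtain ⟨y, hy⟩ := exists_ne (0 : N ⧸ N'.submoduleOf N)
    obtain ⟨x, rfl⟩ := hgs y
    exact hy (by rw [h0]; rfl)
  obtain ⟨e⟩ := hp.nonempty_equiv hg0
  have hmem : ∀ x, x ∈ LinearMap.ker p ↔ θ x ∈ N' := by
    intro x
    rw [← hp.ker_eq hg0, LinearMap.mem_ker]
    simp only [g, LinearMap.comp_apply, Submodule.mkQ_apply, Submodule.Quotient.mk_eq_zero]
    rfl
  refine ⟨⟨e.symm⟩, le_antisymm ?_ ?_⟩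
  · rintro _ ⟨x, hx, rfl⟩
    exact (hmem x).1 hx
  · intro y hy
    have hy' := h.le hy
    rw [← hθ] at hy'
    obtain ⟨x, rfl⟩ := hy'
    exact ⟨x, (hmem x).2 hy, rfl⟩

end IsProjectiveCover

theorem IsUniserialModule.socle_eq {A M : Type u} [Ring A] [AddCommGroup M] [Module A M]
    (hM : IsUniserialModule A M) {N : Submodule A M} (hN : IsAtom N) : socle A M = N := by
  refine le_antisymm (sSup_le fun K hK => ?_) (le_sSup (isSimpleModule_iff_isAtom.2 hN))
  have hK' : IsAtom K := isSimpleModule_iff_isAtom.1 hK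
  rcases hM K N with h | h
  · exact h
  · exact ((hK'.le_iff.1 h).resolve_left hN.1).ge

/-! ### The radical arrows of a Nakayama algebra -/

section Family

variable {A : Type u} [Ring A] {n : ℕ} {S P : Fin n → Type u}
  [∀ i, AddCommGroup (S i)] [∀ i, Module A (S i)] [∀ i, AddCommGroup (P i)] [∀ i, Module A (P i)]

/-- `S j` is the top of the nonzero radical of `P i`. -/
def RadicalArrow (p : ∀ i, P i →ₗ[A] S i) (i j : Fin n) : Prop :=
  LinearMap.ker (p i) ≠ ⊥ ∧ ∃ f : P j →ₗ[A] P i, LinearMap.range f = LinearMap.ker (p i)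

/-- The projective covers of the simple modules over an Artinian Nakayama ring whose simple modules
have uniserial Noetherian hulls. -/
structure IsNakayamaFamily (p : ∀ i, P i →ₗ[A] S i) : Prop where
  artinian : IsArtinianRing A
  nakayama : IsNakayama A
  hulls : HasUniserialHulls A
  complete : IsCompleteSimpleFamily A S
  cover : ∀ i, IsProjectiveCover (p i)

namespace IsNakayamaFamily

variable {p : ∀ i, P i →ₗ[A] S i}

theorem isSimple (h : IsNakayamaFamily p) (i : Fin n) : IsSimpleModule A (S i) := h.complete.1 i

theorem isUniserial (h : IsNakayamaFamily p) (i : Fin n) : IsUniserialModule A (P i) :=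
  have := h.isSimple i
  (h.cover i).isUniserial h.nakayama

theorem isNoetherian_isArtinian (h : IsNakayamaFamily p) (i : Fin n) :
    IsNoetherian A (P i) ∧ IsArtinian A (P i) := by
  have := h.isSimple i
  have := h.artinian
  have := (h.cover i).finite
  exact ⟨inferInstance, inferInstance⟩

/-- Every nonzero finitely generated module receives a nonzero map from some `P k`. -/
theorem exists_comp_ne_zero (h : IsNakayamaFamily p) {M : Type u} [AddCommGroup M] [Module A M]
    {K : Submodule A M} (hK : IsCoatom K) :
    ∃ (k : Fin n) (g : P k →ₗ[A] M), ¬ LinearMap.range g ≤ K := by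
  have hs : IsSimpleModule A (M ⧸ K) := isSimpleModule_iff_isCoatom.2 hK
  obtain ⟨k, ⟨e⟩⟩ := h.complete.2.2 (M ⧸ K) hs
  have := h.isSimple k
  have := (h.cover k).1
  obtain ⟨g, hg⟩ := Module.projective_lifting_property K.mkQ (e.symm.toLinearMap ∘ₗ p k)
    K.mkQ_surjective
  refine ⟨k, g, fun hle => (h.cover k).ne_zero ?_⟩
  ext x
  have h1 : K.mkQ (g x) = 0 := by
    rw [Submodule.mkQ_apply, Submodule.Quotient.mk_eq_zero]
    exact hle ⟨x, rfl⟩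
  have h2 : K.mkQ (g x) = e.symm (p k x) := LinearMap.congr_fun hg x
  rw [h1] at h2
  exact e.symm.injective (h2.symm.trans (map_zero _).symm)

/-- The radical is uniserial with a maximal submodule K, so a map from some `P j` into the radical
not landing in K is onto it. -/
theorem exists_radicalArrow (h : IsNakayamaFamily p) {i : Fin n}
    (hi : LinearMap.ker (p i) ≠ ⊥) : ∃ j, RadicalArrow p i j := by
  have := (h.isNoetherian_isArtinian i).1
  have hnt : Nontrivial (LinearMap.ker (p i)) := Submodule.nontrivial_iff_ne_bot.2 hi
  obtain ⟨K, hK, -⟩ := (eq_top_or_exists_le_coatom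
    (⊥ : Submodule A (LinearMap.ker (p i)))).resolve_left bot_ne_top
  obtain ⟨j, g, hg⟩ := h.exists_comp_ne_zero hK
  refine ⟨j, hi, (LinearMap.ker (p i)).subtype ∘ₗ g, ?_⟩
  have h1 : LinearMap.range g = ⊤ := by
    have hu : LinearMap.range g ≤ K ∨ K ≤ LinearMap.range g := by
      rcases h.isUniserial i ((LinearMap.range g).map (LinearMap.ker (p i)).subtype)
        (K.map (LinearMap.ker (p i)).subtype) with h2 | h2
      · exact Or.inl ((Submodule.map_le_map_iff_of_injective
          (Submodule.subtype_injective _) _ _).1 h2)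
      · exact Or.inr ((Submodule.map_le_map_iff_of_injective
          (Submodule.subtype_injective _) _ _).1 h2)
    exact hK.2 _ (lt_of_le_not_ge (hu.resolve_left hg) hg)
  rw [LinearMap.range_comp, h1, Submodule.map_top, Submodule.range_subtype]

theorem eq_of_comp_ne_zero (h : IsNakayamaFamily p) {i j : Fin n} {f : P i →ₗ[A] P j}
    (hf : p j ∘ₗ f ≠ 0) : i = j := by
  have := h.isSimple i
  have := h.isSimple j
  exact h.complete.2.1 i j ((h.cover i).nonempty_equiv hf)

theorem radicalArrow_right_unique (h : IsNakayamaFamily p) {i j j' : Fin n}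
    (hj : RadicalArrow p i j) (hj' : RadicalArrow p i j') : j = j' := by
  obtain ⟨hi, f, hf⟩ := hj
  obtain ⟨-, f', hf'⟩ := hj'
  have := h.isSimple j'
  obtain ⟨θ, hθ⟩ := (h.cover j).1.exists_comp_eq f' f (by rw [hf, hf'])
  have h1 : Function.Surjective θ := (h.cover j').surjective_of_range_comp (c := f')
    (fun h0 => hi (by rw [← hf', h0, LinearMap.range_zero])) (by rw [hθ, hf, hf'])
  refine h.eq_of_comp_ne_zero (f := θ) fun h0 => (h.cover j').ne_zero ?_
  ext x
  obtain ⟨y, rfl⟩ := h1 x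
  exact LinearMap.congr_fun h0 y

theorem radicalArrow_left_unique (h : IsNakayamaFamily p) {i i' j : Fin n}
    (hi : RadicalArrow p i j) (hi' : RadicalArrow p i' j) : i = i' := by
  obtain ⟨hi, f, hf⟩ := hi
  obtain ⟨hi', f', hf'⟩ := hi'
  have := h.isSimple i
  have := h.isSimple i'
  have := h.isSimple j
  obtain ⟨E, _, _, ι, hE, hEu, -, hι⟩ := h.hulls (S j) this
  refine h.complete.2.1 i i' ((h.cover i).nonempty_equiv_of_range_eq (h.cover j) hE hEu hι hf
    (fun h0 => hi ?_) (h.cover i') hf' (fun h0 => hi' ?_))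
  · rw [← hf, h0, LinearMap.range_zero]
  · rw [← hf', h0, LinearMap.range_zero]

/-- If `S j` is not injective, its hull contains a submodule N covering it. With `P i` mapping onto
the top of N, the radical of `P i` is the preimage of `S j`, and uniseriality of `P i` makes it an
image of `P j`. -/
theorem injective_iff (h : IsNakayamaFamily p) (j : Fin n) :
    Module.Injective A (S j) ↔ ∀ i, ¬ RadicalArrow p i j := by
  have := h.isSimple j
  constructor
  · rintro hinj i ⟨hi, f, hf⟩
    have := h.isSimple i
    refine (h.cover i).not_injective (h.cover j) hf (fun h0 => hi ?_) hinj
    rw [← hf, h0, LinearMap.range_zero]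
  · intro hno
    by_contra hinj
    obtain ⟨E, _, _, ι, hE, hEu, hEn, hι⟩ := h.hulls (S j) this
    have := h.artinian
    have hEa : IsArtinian A E := inferInstance
    have htop : LinearMap.range ι < ⊤ := lt_top_iff_ne_top.2 fun htop =>
        hinj ⟨fun X Y _ _ _ _ f hf g => by
      let e := LinearEquiv.ofBijective ι ⟨hι, LinearMap.range_eq_top.1 htop⟩
      obtain ⟨k, hk⟩ := hE.out f hf (ι ∘ₗ g)
      refine ⟨e.symm.toLinearMap ∘ₗ k, fun x => ?_⟩
      rw [LinearMap.comp_apply, hk]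
      exact e.symm_apply_apply (g x)⟩
    obtain ⟨N, hN, -⟩ := exists_covBy_le_of_lt htop
    obtain ⟨i, g, hg⟩ := h.exists_comp_ne_zero
      (isSimpleModule_iff_isCoatom.1 ((covBy_iff_quot_is_simple hN.le).1 hN))
    have := h.isSimple i
    let α : P i →ₗ[A] E := N.subtype ∘ₗ g
    have hα : LinearMap.range ι ≤ LinearMap.range α := by
      refine (hEu _ _).resolve_right fun hle => hg ?_
      rintro _ ⟨x, rfl⟩
      exact hle ⟨x, rfl⟩
    have hιp := (h.cover j).comp_ne_zero hι
    obtain ⟨θ, hθ⟩ := (h.cover j).1.exists_comp_eq α (ι ∘ₗ p j)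
      ((LinearMap.range_comp_le_range _ _).trans hα)
    have hθ0 : LinearMap.range θ ≠ ⊥ := fun h0 => hιp (by
      rw [← hθ, LinearMap.range_eq_bot.1 h0, LinearMap.comp_zero])
    have hnle : ¬ LinearMap.range θ ≤ LinearMap.ker α := fun h0 => hιp (by
      rw [← hθ, LinearMap.range_le_ker_iff.1 h0])
    have hmem : ∀ x, x ∈ LinearMap.ker (p i) ↔ α x ∈ LinearMap.range ι := by
      have hs : IsSimpleModule A (N ⧸ (LinearMap.range ι).submoduleOf N) :=
        (covBy_iff_quot_is_simple hN.le).1 hN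
      have h0 : ((LinearMap.range ι).submoduleOf N).mkQ ∘ₗ g ≠ 0 := fun h0 => hg (by
        have := LinearMap.range_le_ker_iff.2 h0
        rwa [Submodule.ker_mkQ] at this)
      intro x
      rw [← (h.cover i).ker_eq h0, LinearMap.mem_ker, LinearMap.comp_apply, Submodule.mkQ_apply,
        Submodule.Quotient.mk_eq_zero]
      rfl
    have hrange : LinearMap.range θ = LinearMap.ker (p i) := by
      apply le_antisymm
      · rintro _ ⟨y, rfl⟩
        rw [hmem]
        exact ⟨p j y, (LinearMap.congr_fun hθ y).symm⟩
      · intro x hx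
        obtain ⟨s, hs⟩ := (hmem x).1 hx
        obtain ⟨y, rfl⟩ := (h.cover j).2.1 s
        have h1 : x - θ y ∈ LinearMap.ker α := by
          rw [LinearMap.mem_ker, map_sub, sub_eq_zero, ← hs]
          exact (LinearMap.congr_fun hθ y).symm
        have h2 := (h.isUniserial i _ _).resolve_left hnle
        have := add_mem (h2 h1) (LinearMap.mem_range_self θ y)
        rwa [sub_add_cancel] at this
    exact hno i ⟨hrange ▸ hθ0, θ, hrange⟩

/-! ### Connectedness -/

/-- No nonzero map from a projective cover `P k` with `k ∉ W` has its image in `N`. -/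
def SupportedOn (P : Fin n → Type u) [∀ i, AddCommGroup (P i)] [∀ i, Module A (P i)]
    (W : Set (Fin n)) (N : Submodule A A) : Prop :=
  ∀ k ∉ W, ∀ g : P k →ₗ[A] A, LinearMap.range g ≤ N → g = 0

theorem SupportedOn.sup (h : IsNakayamaFamily p) {W : Set (Fin n)} {N N' : Submodule A A}
    (hN : SupportedOn P W N) (hN' : SupportedOn P W N') : SupportedOn P W (N ⊔ N') := by
  intro k hk g hg
  obtain ⟨θ, hθ⟩ := (h.cover k).1.exists_comp_eq (N.subtype.coprod N'.subtype) g (by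
    rwa [LinearMap.range_coprod, Submodule.range_subtype, Submodule.range_subtype])
  have h1 := hN k hk (N.subtype ∘ₗ LinearMap.fst A N N' ∘ₗ θ) (by
    rintro _ ⟨x, rfl⟩
    exact (θ x).1.2)
  have h2 := hN' k hk (N'.subtype ∘ₗ LinearMap.snd A N N' ∘ₗ θ) (by
    rintro _ ⟨x, rfl⟩
    exact (θ x).2.2)
  rw [← hθ]
  ext x
  have e1 := LinearMap.congr_fun h1 x
  have e2 := LinearMap.congr_fun h2 x
  simp only [LinearMap.comp_apply, LinearMap.fst_apply, LinearMap.snd_apply] at e1 e2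
  rw [LinearMap.comp_apply, LinearMap.coprod_apply, e1, e2]
  simp

theorem SupportedOn.map (h : IsNakayamaFamily p) {W : Set (Fin n)} {N : Submodule A A}
    (hN : SupportedOn P W N) (φ : A →ₗ[A] A) : SupportedOn P W (N.map φ) := by
  intro k hk g hg
  obtain ⟨θ, hθ⟩ := (h.cover k).1.exists_comp_eq (φ ∘ₗ N.subtype) g (by
    rwa [LinearMap.range_comp, Submodule.range_subtype])
  have h1 := hN k hk (N.subtype ∘ₗ θ) (by
    rintro _ ⟨x, rfl⟩
    exact (θ x).2)
  rw [← hθ, LinearMap.comp_assoc, h1, LinearMap.comp_zero]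

/-- As k ≠ i, the map g lands in the radical of `P i` and so factors through some `P j` with j ∈ W.
The image of θ shrinks at each such step, and induction ends at zero. -/
theorem comp_eq_zero_of_closed (h : IsNakayamaFamily p) {W : Set (Fin n)}
    (hW : ∀ i j, RadicalArrow p i j → (i ∈ W ↔ j ∈ W)) {k : Fin n} (hk : k ∉ W) {i : Fin n}
    (hi : i ∈ W) (θ : P i →ₗ[A] A) (g : P k →ₗ[A] P i) : θ ∘ₗ g = 0 := by
  have := h.artinian
  induction hN : LinearMap.range θ using WellFoundedLT.induction generalizing i with
  | ind N ih =>
    by_cases hθ0 : θ = 0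
    · rw [hθ0, LinearMap.zero_comp]
    have := h.isSimple i
    by_cases hg : p i ∘ₗ g = 0
    · have hle : LinearMap.range g ≤ LinearMap.ker (p i) := LinearMap.range_le_ker_iff.2 hg
      by_cases hker : LinearMap.ker (p i) = ⊥
      · rw [hker, le_bot_iff, LinearMap.range_eq_bot] at hle
        rw [hle, LinearMap.comp_zero]
      obtain ⟨j, hj⟩ := h.exists_radicalArrow hker
      obtain ⟨f, hf⟩ := hj.2
      obtain ⟨g', rfl⟩ := (h.cover k).1.exists_comp_eq f g (by rwa [hf])
      rw [← LinearMap.comp_assoc]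
      refine ih (LinearMap.range (θ ∘ₗ f)) ?_ ((hW i j hj).1 hi) (θ ∘ₗ f) g' rfl
      rw [← hN]
      refine lt_of_le_not_ge (LinearMap.range_comp_le_range _ _) fun hge => ?_
      have hs := (h.cover i).surjective_of_range_comp hθ0 hge
      rw [← LinearMap.range_eq_top, hf] at hs
      exact (h.cover i).isCoatom_ker.1 hs
    · exact absurd (h.eq_of_comp_ne_zero hg ▸ hi) hk

theorem supportedOn_range (h : IsNakayamaFamily p) {W : Set (Fin n)}
    (hW : ∀ i j, RadicalArrow p i j → (i ∈ W ↔ j ∈ W)) {i : Fin n} (hi : i ∈ W)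
    (θ : P i →ₗ[A] A) : SupportedOn P W (LinearMap.range θ) := by
  intro k hk g hg
  obtain ⟨g', rfl⟩ := (h.cover k).1.exists_comp_eq θ g hg
  exact h.comp_eq_zero_of_closed hW hk hi θ g'

theorem exists_greatest_supportedOn (h : IsNakayamaFamily p) (W : Set (Fin n)) :
    ∃ N : Submodule A A, SupportedOn P W N ∧ ∀ N', SupportedOn P W N' → N' ≤ N := by
  have := h.artinian
  obtain ⟨N, hN, hmax⟩ := WellFounded.has_min (wellFounded_gt (α := Submodule A A))
    {N | SupportedOn P W N} ⟨⊥, fun k _ g hg => LinearMap.range_eq_bot.1 (le_bot_iff.1 hg)⟩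
  refine ⟨N, hN, fun N' hN' => ?_⟩
  by_contra hle
  exact hmax _ (SupportedOn.sup h hN hN') (left_lt_sup.2 hle)

theorem exists_ne_zero (h : IsNakayamaFamily p) (k : Fin n) : ∃ g : P k →ₗ[A] A, g ≠ 0 := by
  have := h.isSimple k
  have := (h.cover k).1
  obtain ⟨x, hx⟩ := (h.cover k).exists_span_eq_top
  have hs : Function.Surjective (LinearMap.toSpanSingleton A (P k) x) := by
    rw [← LinearMap.range_eq_top, LinearMap.range_toSpanSingleton, hx]
  obtain ⟨g, hg⟩ := Module.projective_lifting_property _ LinearMap.id hs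
  refine ⟨g, fun h0 => (h.cover k).ne_zero ?_⟩
  rw [← LinearMap.comp_id (p k), ← hg, h0, LinearMap.comp_zero, LinearMap.comp_zero]

/-- The greatest left ideals N and N' supported on W and on its complement are two-sided and satisfy
A = N ⊕ N'. The decomposition of 1 gives a central idempotent, and its triviality leaves one of the
two vertex sets empty. -/
theorem eq_empty_or_eq_univ (h : IsNakayamaFamily p) (hconn : IsConnectedRing A)
    {W : Set (Fin n)} (hW : ∀ i j, RadicalArrow p i j → (i ∈ W ↔ j ∈ W)) :
    W = ∅ ∨ W = Set.univ := by
  have hart := h.artinian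
  have hW' : ∀ i j, RadicalArrow p i j → (i ∈ Wᶜ ↔ j ∈ Wᶜ) := fun i j hij => not_congr (hW i j hij)
  obtain ⟨N, hN, hNmax⟩ := h.exists_greatest_supportedOn W
  obtain ⟨N', hN', hNmax'⟩ := h.exists_greatest_supportedOn Wᶜ
  have hsup : N ⊔ N' = ⊤ := by
    by_contra hne
    obtain ⟨m, hm, hle⟩ := (eq_top_or_exists_le_coatom _).resolve_left hne
    obtain ⟨k, g, hg⟩ := h.exists_comp_ne_zero hm
    by_cases hk : k ∈ W
    · exact hg ((hNmax _ (h.supportedOn_range hW hk g)).trans (le_sup_left.trans hle))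
    · exact hg ((hNmax' _ (h.supportedOn_range hW' hk g)).trans (le_sup_right.trans hle))
  have hinf : ∀ x, x ∈ N → x ∈ N' → x = 0 := by
    intro x hx hx'
    by_contra hx0
    have hb : N ⊓ N' ≠ ⊥ := fun hb => hx0 (by
      have : x ∈ N ⊓ N' := ⟨hx, hx'⟩
      rwa [hb] at this)
    have hnt : Nontrivial (N ⊓ N' : Submodule A A) := Submodule.nontrivial_iff_ne_bot.2 hb
    obtain ⟨K, hK, -⟩ := (eq_top_or_exists_le_coatom
      (⊥ : Submodule A (N ⊓ N' : Submodule A A))).resolve_left bot_ne_top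
    obtain ⟨k, g, hg⟩ := h.exists_comp_ne_zero hK
    have hle : LinearMap.range ((N ⊓ N').subtype ∘ₗ g) ≤ N ⊓ N' := by
      rintro _ ⟨y, rfl⟩
      exact (g y).2
    have h0 : (N ⊓ N').subtype ∘ₗ g = 0 := by
      by_cases hk : k ∈ W
      · exact hN' k (fun hk' => hk' hk) _ (hle.trans inf_le_right)
      · exact hN k hk _ (hle.trans inf_le_left)
    refine hg ?_
    rintro _ ⟨y, rfl⟩
    rw [show g y = 0 from Subtype.ext (LinearMap.congr_fun h0 y)]
    exact K.zero_mem
  -- Right multiplication is a left-linear endomorphism, and images of supported submodules are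
  -- supported, so maximality makes N a right ideal.
  have hmul : ∀ {x : A}, x ∈ N → ∀ a, x * a ∈ N := fun hx a =>
    hNmax _ (SupportedOn.map h hN (LinearMap.toSpanSingleton A A a)) ⟨_, hx, rfl⟩
  have hmul' : ∀ {x : A}, x ∈ N' → ∀ a, x * a ∈ N' := fun hx a =>
    hNmax' _ (SupportedOn.map h hN' (LinearMap.toSpanSingleton A A a)) ⟨_, hx, rfl⟩
  obtain ⟨e, he, e', he', hee'⟩ := Submodule.mem_sup.1 (hsup ▸ Submodule.mem_top : (1 : A) ∈ N ⊔ N')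
  have h1 : e * e' = 0 := hinf _ (hmul he e') (N'.smul_mem e he')
  have hidem : e * e = e := by
    calc e * e = e * (e + e') := by rw [mul_add, h1, add_zero]
      _ = e := by rw [hee', mul_one]
  have hcen : ∀ a, e * a = a * e := by
    intro a
    have h2 : e * a - a * e = a * e' - e' * a := by
      rw [sub_eq_sub_iff_add_eq_add, ← add_mul, hee', ← mul_add, add_comm e' e, hee', one_mul,
        mul_one]
    rw [← sub_eq_zero]
    refine hinf _ (N.sub_mem (hmul he a) (N.smul_mem a he)) ?_
    rw [h2]
    exact N'.sub_mem (N'.smul_mem a he') (hmul' he' a)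
  rcases hconn.2 e hidem hcen with h0 | h0
  · left
    rw [Set.eq_empty_iff_forall_notMem]
    intro k hk
    obtain ⟨g, hg⟩ := h.exists_ne_zero k
    refine hg (hN' k (fun hk' => hk' hk) g fun x _ => ?_)
    rw [h0, zero_add] at hee'
    have := N'.smul_mem x (hee' ▸ he')
    rwa [smul_eq_mul, mul_one] at this
  · right
    rw [Set.eq_univ_iff_forall]
    intro k
    by_contra hk
    obtain ⟨g, hg⟩ := h.exists_ne_zero k
    refine hg (hN k hk g fun x _ => ?_)
    have := N.smul_mem x (h0 ▸ he)
    rwa [smul_eq_mul, mul_one] at this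

/-- The radical arrows extend to a cyclic permutation. -/
theorem exists_perm (h : IsNakayamaFamily p) (hconn : IsConnectedRing A) :
    ∃ σ : Equiv.Perm (Fin n), (∀ i j, RadicalArrow p i j → j = σ i) ∧
      (∀ i j, ∃ t : ℕ, (σ ^ t) i = j) ∧
      ∀ i i', LinearMap.ker (p i) = ⊥ → LinearMap.ker (p i') = ⊥ → i = i' := by
  classical
  choose s hs using fun i : {i // LinearMap.ker (p i) ≠ ⊥} => h.exists_radicalArrow i.2
  let e : {i // LinearMap.ker (p i) ≠ ⊥} ≃ {j // ∃ i, RadicalArrow p i j} :=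
    Equiv.ofBijective (fun i => ⟨s i, i, hs i⟩) ⟨fun i i' hii' => by
        have h1 : s i = s i' := congrArg Subtype.val hii'
        exact Subtype.ext (h.radicalArrow_left_unique (hs i) (h1 ▸ hs i')), fun ⟨j, i, hij⟩ =>
      ⟨⟨i, hij.1⟩, Subtype.ext (h.radicalArrow_right_unique (hs ⟨i, hij.1⟩) hij)⟩⟩
  -- The radical arrows are a bijection between two subsets of the vertices, extended arbitrarily;
  -- the last clause leaves at most one vertex without an outgoing arrow.
  let σ : Equiv.Perm (Fin n) := e.extendSubtype
  have hσ : ∀ i j, RadicalArrow p i j → j = σ i := by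
    intro i j hij
    have : σ i = s ⟨i, hij.1⟩ := e.extendSubtype_apply_of_mem i hij.1
    rw [this]
    exact h.radicalArrow_right_unique hij (hs ⟨i, hij.1⟩)
  refine ⟨σ, hσ, fun i j => ?_, fun i i' hi hi' => ?_⟩
  · have hW : ∀ a b, RadicalArrow p a b →
        (a ∈ {k | σ.SameCycle i k} ↔ b ∈ {k | σ.SameCycle i k}) := by
      intro a b hab
      rw [hσ a b hab]
      exact Equiv.Perm.sameCycle_apply_right.symm
    have hj : j ∈ {k | σ.SameCycle i k} := by
      rcases h.eq_empty_or_eq_univ hconn hW with h0 | h0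
      · exact absurd (h0 ▸ (Equiv.Perm.SameCycle.refl σ i : i ∈ {k | σ.SameCycle i k}))
          (Set.notMem_empty i)
      · rw [h0]; exact Set.mem_univ j
    obtain ⟨t, -, ht⟩ := Equiv.Perm.SameCycle.exists_pow_eq' hj
    exact ⟨t, ht⟩
  -- W consists of the vertices from which i is reached along genuine arrows. It is closed under
  -- arrows in both directions, so it is everything, yet i is its only member with zero radical.
  · let W : Set (Fin n) := {x | ∃ t : ℕ, (σ ^ t) x = i ∧
      ∀ r < t, LinearMap.ker (p ((σ ^ r) x)) ≠ ⊥}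
    have hW : ∀ a b, RadicalArrow p a b → (a ∈ W ↔ b ∈ W) := by
      intro a b hab
      have hb := hσ a b hab
      constructor
      · rintro ⟨t, ht, hr⟩
        cases t with
        | zero =>
          have ha : a = i := ht
          exact absurd hi (ha ▸ hab.1)
        | succ t =>
          refine ⟨t, ?_, fun r hrt => ?_⟩
          · rw [hb, ← Equiv.Perm.mul_apply, ← pow_succ]; exact ht
          · have := hr (r + 1) (by omega)
            rwa [pow_succ, Equiv.Perm.mul_apply, ← hb] at this
      · rintro ⟨t, ht, hr⟩
        refine ⟨t + 1, ?_, fun r hrt => ?_⟩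
        · rw [pow_succ, Equiv.Perm.mul_apply, ← hb]; exact ht
        · cases r with
          | zero => exact hab.1
          | succ r =>
            rw [pow_succ, Equiv.Perm.mul_apply, ← hb]
            exact hr r (by omega)
    have hiW : i ∈ W := ⟨0, rfl, fun r hr => absurd hr (Nat.not_lt_zero r)⟩
    have hiW' : i' ∈ W := by
      rcases h.eq_empty_or_eq_univ hconn hW with h0 | h0
      · exact absurd (h0 ▸ hiW) (Set.notMem_empty i)
      · rw [h0]; exact Set.mem_univ i'
    obtain ⟨t, ht, hr⟩ := hiW'
    cases t with
    | zero => exact ht.symm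
    | succ t => exact absurd hi' (hr 0 (Nat.succ_pos t))

end IsNakayamaFamily

end Family

/-! ### Composition series, socles and projective dimensions -/

section ProjectiveDimension

open CategoryTheory

/-- In 0 → ker p → P → S → 0 the dimension is at most 1 iff the kernel is projective, and at least 1
iff S is not projective, that is, iff the kernel is nonzero. -/
theorem projectiveDimension_eq_one_iff {A P S : Type u} [Ring A] [AddCommGroup P] [Module A P]
    [AddCommGroup S] [Module A S] [IsSimpleModule A S] {p : P →ₗ[A] S}
    (hp : IsProjectiveCover p) :
    projectiveDimension (ModuleCat.of A S) = 1 ↔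
      LinearMap.ker p ≠ ⊥ ∧ Module.Projective A (LinearMap.ker p) := by
  have hP : Projective (ModuleCat.of A P) := (IsProjective.iff_projective _).1 hp.1
  let C : ShortComplex (ModuleCat.{u} A) := ShortComplex.mk
    (ModuleCat.ofHom (LinearMap.ker p).subtype) (ModuleCat.ofHom p) (by
      ext x
      exact x.2)
  have hC : C.ShortExact :=
    { exact := by
        rw [ShortComplex.moduleCat_exact_iff]
        intro x hx
        exact ⟨⟨x, hx⟩, rfl⟩
      mono_f := (ModuleCat.mono_iff_injective _).2 (Submodule.subtype_injective _)
      epi_g := (ModuleCat.epi_iff_surjective _).2 hp.2.1 }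
  have h2 : projectiveDimension (ModuleCat.of A S) ≤ 1 ↔
      Module.Projective A (LinearMap.ker p) := by
    have := hC.hasProjectiveDimensionLT_X₃_iff 0 hP
    rw [show (1 : WithBot ℕ∞) = ((1 : ℕ) : WithBot ℕ∞) from rfl, projectiveDimension_le_iff]
    refine this.trans ?_
    rw [zero_add, ← projective_iff_hasProjectiveDimensionLT_one]
    exact (IsProjective.iff_projective _).symm
  have h1 : 1 ≤ projectiveDimension (ModuleCat.of A S) ↔ LinearMap.ker p ≠ ⊥ := by
    rw [show (1 : WithBot ℕ∞) = ((1 : ℕ) : WithBot ℕ∞) from rfl, projectiveDimension_ge_iff,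
      ← projective_iff_hasProjectiveDimensionLT_one, not_iff_not, ← hp.projective_iff]
    exact (IsProjective.iff_projective _).symm
  rw [le_antisymm_iff, h1, h2, and_comm]

end ProjectiveDimension

/-! ### Lengths, Cartan numbers and socles of the indecomposable projectives. -/

section Family

variable {A : Type u} [Ring A] {n : ℕ} {S P : Fin n → Type u}
  [∀ i, AddCommGroup (S i)] [∀ i, Module A (S i)] [∀ i, AddCommGroup (P i)] [∀ i, Module A (P i)]

/-- The composition length of `P i`. -/
noncomputable def projectiveLength (A : Type u) [Ring A] {n : ℕ} (P : Fin n → Type u)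
    [∀ i, AddCommGroup (P i)] [∀ i, Module A (P i)] (i : Fin n) : ℕ :=
  (Module.length A (P i)).toNat

namespace IsNakayamaFamily

variable {p : ∀ i, P i →ₗ[A] S i}

theorem coe_projectiveLength (h : IsNakayamaFamily p) (i : Fin n) :
    (projectiveLength A P i : ℕ∞) = Module.length A (P i) := by
  obtain ⟨_, _⟩ := h.isNoetherian_isArtinian i
  exact ENat.natCast_toNat Module.length_ne_top

theorem projectiveLength_eq (h : IsNakayamaFamily p) (i : Fin n) :
    (projectiveLength A P i : ℕ∞) = Module.length A (LinearMap.ker (p i)) + 1 := by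
  have := h.isSimple i
  rw [h.coe_projectiveLength, Module.length_eq_add_of_exact (LinearMap.ker (p i)).subtype (p i)
    (Submodule.subtype_injective _) (h.cover i).2.1 (LinearMap.exact_subtype_ker_map (p i)),
    Module.length_eq_one A (S i)]

theorem one_le_projectiveLength (h : IsNakayamaFamily p) (i : Fin n) :
    1 ≤ projectiveLength A P i := by
  have := h.projectiveLength_eq i
  have h1 : (1 : ℕ∞) ≤ projectiveLength A P i := by
    rw [this]
    exact le_add_self
  exact_mod_cast h1

theorem projectiveLength_eq_one (h : IsNakayamaFamily p) {i : Fin n}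
    (hi : LinearMap.ker (p i) = ⊥) : projectiveLength A P i = 1 := by
  have := h.projectiveLength_eq i
  rw [hi, Module.length_bot, zero_add] at this
  exact_mod_cast this

theorem projectiveLength_le (h : IsNakayamaFamily p) {σ : Equiv.Perm (Fin n)}
    (hσ : ∀ i j, RadicalArrow p i j → j = σ i) (i : Fin n) :
    projectiveLength A P i ≤ projectiveLength A P (σ i) + 1 := by
  by_cases hi : LinearMap.ker (p i) = ⊥
  · rw [h.projectiveLength_eq_one hi]
    omega
  · obtain ⟨j, hj⟩ := h.exists_radicalArrow hi
    obtain rfl := hσ i j hj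
    obtain ⟨f, hf⟩ := hj.2
    have h1 := Module.length_le_of_surjective
      (f.codRestrict (LinearMap.ker (p i)) fun x => hf ▸ ⟨x, rfl⟩) (by
        rintro ⟨y, hy⟩
        rw [← hf] at hy
        obtain ⟨x, rfl⟩ := hy
        exact ⟨x, rfl⟩)
    rw [← h.coe_projectiveLength] at h1
    have h2 : (projectiveLength A P i : ℕ∞) ≤ projectiveLength A P (σ i) + 1 := by
      rw [h.projectiveLength_eq i]
      gcongr
    exact_mod_cast h2

/-- The radical of `P i` is a quotient of the local module `P (σ i)`. It is projective exactly when
this quotient map is bijective, that is, when the lengths agree. -/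
theorem projectiveDimension_eq_one_iff (h : IsNakayamaFamily p) {σ : Equiv.Perm (Fin n)}
    (hσ : ∀ i j, RadicalArrow p i j → j = σ i) (i : Fin n) :
    CategoryTheory.projectiveDimension (ModuleCat.of A (S i)) = 1 ↔
      projectiveLength A P i = projectiveLength A P (σ i) + 1 := by
  have := h.isSimple i
  rw [_root_.projectiveDimension_eq_one_iff (h.cover i)]
  by_cases hi : LinearMap.ker (p i) = ⊥
  · have h1 := h.one_le_projectiveLength (σ i)
    rw [h.projectiveLength_eq_one hi]
    constructor
    · exact fun h2 => absurd hi h2.1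
    · intro h2
      omega
  · obtain ⟨j, hj⟩ := h.exists_radicalArrow hi
    obtain rfl := hσ i j hj
    obtain ⟨f, hf⟩ := hj.2
    obtain ⟨_, _⟩ := h.isNoetherian_isArtinian i
    obtain ⟨_, _⟩ := h.isNoetherian_isArtinian (σ i)
    have hsσ := h.isSimple (σ i)
    let c : P (σ i) →ₗ[A] LinearMap.ker (p i) :=
      f.codRestrict (LinearMap.ker (p i)) fun x => hf ▸ ⟨x, rfl⟩
    have hc : Function.Surjective c := by
      rintro ⟨y, hy⟩
      rw [← hf] at hy
      obtain ⟨x, rfl⟩ := hy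
      exact ⟨x, rfl⟩
    have hlen : projectiveLength A P i = projectiveLength A P (σ i) + 1 ↔
        Module.length A (LinearMap.ker (p i)) = Module.length A (P (σ i)) := by
      have h1 := h.projectiveLength_eq i
      rw [← h.coe_projectiveLength]
      have h2 : Module.length A (LinearMap.ker (p i)) ≠ ⊤ := Module.length_ne_top
      lift Module.length A (LinearMap.ker (p i)) to ℕ using h2 with m
      norm_cast at h1 ⊢
      omega
    rw [hlen]
    constructor
    · rintro ⟨-, hproj⟩
      obtain ⟨s, hs⟩ := Module.projective_lifting_property c LinearMap.id hc
      have hss : Function.Surjective s := by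
        refine (h.cover (σ i)).surjective_of_range_comp (c := c) (fun h0 => hi ?_) ?_
        · rw [← Submodule.subsingleton_iff_eq_bot]
          refine ⟨fun x y => ?_⟩
          obtain ⟨x, rfl⟩ := hc x
          obtain ⟨y, rfl⟩ := hc y
          rw [h0]
          rfl
        · rw [hs, LinearMap.range_id]
          exact le_top
      refine le_antisymm (Module.length_le_of_injective s fun x y hxy => ?_)
        (Module.length_le_of_surjective s hss)
      have := congrArg c hxy
      rwa [← LinearMap.comp_apply, ← LinearMap.comp_apply, hs] at this
    · intro h1
      refine ⟨hi, ?_⟩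
      have hk : LinearMap.ker c = ⊥ := by
        have h2 := Module.length_eq_add_of_exact (LinearMap.ker c).subtype c
          (Submodule.subtype_injective _) hc (LinearMap.exact_subtype_ker_map c)
        rw [h1] at h2
        have h3 : Module.length A (P (σ i)) ≠ ⊤ := Module.length_ne_top
        have h4 : Module.length A (LinearMap.ker c) = 0 := by
          lift Module.length A (P (σ i)) to ℕ using h3 with m
          have h5 : Module.length A (LinearMap.ker c) ≠ ⊤ := Module.length_ne_top
          lift Module.length A (LinearMap.ker c) to ℕ using h5 with l
          norm_cast at h2 ⊢
          omega
        rw [Module.length_eq_zero_iff] at h4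
        exact (Submodule.subsingleton_iff_eq_bot).1 h4
      have := (h.cover (σ i)).1
      exact Module.Projective.of_equiv
        (LinearEquiv.ofBijective c ⟨LinearMap.ker_eq_bot.1 hk, hc⟩)

/-- The terms of a composition series of `P j`, from the top. -/
theorem exists_range_eq (h : IsNakayamaFamily p) {σ : Equiv.Perm (Fin n)}
    (hσ : ∀ i j, RadicalArrow p i j → j = σ i) {j : Fin n}
    (s : CompositionSeries (Submodule A (P j))) (h1 : s.last = ⊤)
    (t : ℕ) (k : Fin s.length) (hk : (k : ℕ) + t + 1 = s.length) :
    ∃ θ : P ((σ ^ t) j) →ₗ[A] P j, LinearMap.range θ = s k.succ := by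
  induction t generalizing k with
  | zero =>
    have htop : s k.succ = ⊤ := by
      rw [← h1, RelSeries.last]
      congr 1
      ext
      simp
      omega
    exact ⟨(LinearMap.id : P j →ₗ[A] P j), LinearMap.range_id.trans htop.symm⟩
  | succ t ih =>
    obtain ⟨θ, hθ⟩ := ih ⟨k + 1, by omega⟩ (by simp; omega)
    have hsimp := h.isSimple ((σ ^ t) j)
    have hstep : s k.succ ⋖ s (Fin.succ ⟨k + 1, by omega⟩) := s.step ⟨k + 1, by omega⟩
    obtain ⟨-, hmap⟩ := (h.cover _).quotient_equiv_and_map_ker hstep hθ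
    have hne : s k.succ ≠ ⊥ := by
      intro hb
      have hlt : s k.castSucc < s k.succ := (s.step k).lt
      rw [hb] at hlt
      exact not_lt_bot hlt
    have hker : LinearMap.ker (p ((σ ^ t) j)) ≠ ⊥ := fun hb => hne (by
      rw [← hmap, hb, Submodule.map_bot])
    obtain ⟨m, hm⟩ := h.exists_radicalArrow hker
    obtain rfl : m = (σ ^ (t + 1)) j := by
      rw [hσ _ _ hm, pow_succ', Equiv.Perm.mul_apply]
    obtain ⟨f, hf⟩ := hm.2
    exact ⟨θ ∘ₗ f, by rw [LinearMap.range_comp, hf, hmap]⟩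

theorem exists_compositionSeries (h : IsNakayamaFamily p) (j : Fin n) :
    ∃ s : CompositionSeries (Submodule A (P j)), s.head = ⊥ ∧ s.last = ⊤ :=
  isFiniteLength_iff_exists_compositionSeries.1
    (isFiniteLength_iff_isNoetherian_isArtinian.2 (h.isNoetherian_isArtinian j))

theorem length_eq_projectiveLength (h : IsNakayamaFamily p) {j : Fin n}
    (s : CompositionSeries (Submodule A (P j))) (h0 : s.head = ⊥) (h1 : s.last = ⊤) :
    s.length = projectiveLength A P j := by
  have := Module.length_compositionSeries s h0 h1
  rw [← h.coe_projectiveLength] at this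
  exact_mod_cast this

/-- The series is indexed from the bottom and the powers of `σ` from the top, hence the reindexing k
↔ length - 1 - k. -/
theorem compositionMultiplicity_eq (h : IsNakayamaFamily p) {σ : Equiv.Perm (Fin n)}
    (hσ : ∀ i j, RadicalArrow p i j → j = σ i) (i j : Fin n) :
    compositionMultiplicity A (P j) (S i) =
      ((Finset.range (projectiveLength A P j)).filter fun t => (σ ^ t) j = i).card := by
  have hex := h.exists_compositionSeries j
  rw [compositionMultiplicity, dif_pos hex]
  obtain ⟨h0, h1⟩ := hex.choose_spec
  set s := hex.choose
  have hiff : ∀ k : Fin s.length,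
      Nonempty ((s k.succ ⧸ (s k.castSucc).submoduleOf (s k.succ)) ≃ₗ[A] S i) ↔
        (σ ^ (s.length - 1 - k)) j = i := by
    intro k
    obtain ⟨θ, hθ⟩ := h.exists_range_eq hσ s h1 (s.length - 1 - k) k (by omega)
    have hsimp := h.isSimple ((σ ^ (s.length - 1 - (k : ℕ))) j)
    obtain ⟨⟨e⟩, -⟩ := (h.cover _).quotient_equiv_and_map_ker (s.step k) hθ
    constructor
    · rintro ⟨e'⟩
      exact h.complete.2.1 _ _ ⟨e.symm ≪≫ₗ e'⟩
    · rintro rfl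
      exact ⟨e⟩
  rw [compositionCount, ← h.length_eq_projectiveLength s h0 h1]
  simp only [hiff]
  rw [Nat.card_eq_fintype_card, Fintype.card_subtype]
  refine Finset.card_bij' (fun k _ => s.length - 1 - (k : ℕ))
    (fun t ht => ⟨s.length - 1 - t, by have := Finset.mem_range.1 (Finset.mem_filter.1 ht).1; omega⟩)
    ?_ ?_ ?_ ?_
  · intro k hk
    have := k.2
    exact Finset.mem_filter.2 ⟨Finset.mem_range.2 (by omega), (Finset.mem_filter.1 hk).2⟩
  · intro t ht
    obtain ⟨ht1, ht2⟩ := Finset.mem_filter.1 ht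
    rw [Finset.mem_range] at ht1
    refine Finset.mem_filter.2 ⟨Finset.mem_univ _, ?_⟩
    rwa [show s.length - 1 - (s.length - 1 - t) = t by omega]
  · intro k hk
    have := k.2
    ext
    simp only
    omega
  · intro t ht
    have := Finset.mem_range.1 (Finset.mem_filter.1 ht).1
    simp only
    omega

theorem nonempty_socle_equiv (h : IsNakayamaFamily p) {σ : Equiv.Perm (Fin n)}
    (hσ : ∀ i j, RadicalArrow p i j → j = σ i) (j : Fin n) :
    Nonempty (S ((σ ^ (projectiveLength A P j - 1)) j) ≃ₗ[A] socle A (P j)) := by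
  obtain ⟨s, h0, h1⟩ := h.exists_compositionSeries j
  have hlen := h.length_eq_projectiveLength s h0 h1
  have hpos := h.one_le_projectiveLength j
  obtain ⟨θ, hθ⟩ := h.exists_range_eq hσ s h1 (projectiveLength A P j - 1) ⟨0, by omega⟩
    (by simp; omega)
  have hatom : IsAtom (LinearMap.range θ) := by
    rw [hθ, ← bot_covBy_iff, ← h0]
    exact s.step ⟨0, by omega⟩
  rw [(h.isUniserial j).socle_eq hatom]
  have := isSimpleModule_iff_isAtom.2 hatom
  have := h.isSimple ((σ ^ (projectiveLength A P j - 1)) j)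
  refine (h.cover _).nonempty_equiv (f := θ.rangeRestrict) fun h2 => hatom.1 ?_
  rw [LinearMap.range_eq_bot]
  ext x
  exact congrArg Subtype.val (LinearMap.congr_fun h2 x)

theorem isKupisch (h : IsNakayamaFamily p) {σ : Equiv.Perm (Fin n)}
    (hσ : ∀ i j, RadicalArrow p i j → j = σ i) (htr : ∀ i j, ∃ t : ℕ, (σ ^ t) i = j) :
    IsKupisch σ (projectiveLength A P) :=
  ⟨htr, h.one_le_projectiveLength, h.projectiveLength_le hσ⟩

theorem cartanMatrix_eq (h : IsNakayamaFamily p) {σ : Equiv.Perm (Fin n)}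
    (hσ : ∀ i j, RadicalArrow p i j → j = σ i) :
    cartanMatrix A S P = kupischMatrix σ (projectiveLength A P) := by
  ext i j
  simp only [cartanMatrix, kupischMatrix, Matrix.of_apply, h.compositionMultiplicity_eq hσ]

end IsNakayamaFamily

end Family

/-! ### The Auslander–Reiten translate of a simple module -/

section Family

variable {A : Type u} [Ring A] {n : ℕ} {S P : Fin n → Type u}
  [∀ i, AddCommGroup (S i)] [∀ i, Module A (S i)] [∀ i, AddCommGroup (P i)] [∀ i, Module A (P i)]

namespace IsNakayamaFamily

variable {p : ∀ i, P i →ₗ[A] S i}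

theorem exists_surjective (h : IsNakayamaFamily p) {X : Type u} [AddCommGroup X] [Module A X]
    (hX : Module.Projective A X) {K : Submodule A X} (hK : IsCoatom K) :
    ∃ (k : Fin n) (c : X →ₗ[A] P k), Function.Surjective c := by
  have hs : IsSimpleModule A (X ⧸ K) := isSimpleModule_iff_isCoatom.2 hK
  obtain ⟨k, ⟨e⟩⟩ := h.complete.2.2 (X ⧸ K) hs
  have := h.isSimple k
  obtain ⟨c, hc⟩ := Module.projective_lifting_property (p k) (e.toLinearMap ∘ₗ K.mkQ) (h.cover k).2.1
  refine ⟨k, c, (h.cover k).surjective_of_comp_ne_zero fun h0 => ?_⟩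
  have := IsSimpleModule.nontrivial A (S k)
  obtain ⟨y, hy⟩ := exists_ne (0 : S k)
  obtain ⟨x, rfl⟩ := (e.surjective.comp K.mkQ_surjective) y
  rw [hc] at h0
  exact hy (LinearMap.congr_fun h0 x)

/-! ### The transpose of a simple module and its dual. -/

section Presentation

variable {P₁ P₀ T T₁ : Type u} [AddCommGroup P₁] [Module A P₁] [AddCommGroup P₀] [Module A P₀]
  [AddCommGroup T] [Module A T] [AddCommGroup T₁] [Module A T₁] [IsSimpleModule A T]
  [IsSimpleModule A T₁] {f : P₁ →ₗ[A] P₀} {p₀ : P₀ →ₗ[A] T} {q : P₁ →ₗ[A] T₁}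

/-- A map from `P₁` to a projective module which is not a split monomorphism factors through
`f : P₁ → P₀`, if the image of `f` is the radical of `P₀`. -/
theorem exists_comp_eq_of_forall (h : IsNakayamaFamily p) (hp₀ : IsProjectiveCover p₀)
    (hq : IsProjectiveCover q) (hf : LinearMap.range f = LinearMap.ker p₀) (hf0 : f ≠ 0)
    (N : ℕ) {X : Type u} [AddCommGroup X] [Module A X] (hX : Module.Projective A X)
    (hfin : Module.Finite A X) (hN : Module.length A X ≤ N) (g : P₁ →ₗ[A] X)
    (hg : ∀ k (c : X →ₗ[A] P k), ¬ Function.Surjective (c ∘ₗ g)) :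
    ∃ θ : P₀ →ₗ[A] X, θ ∘ₗ f = g := by
  obtain ⟨E, _, _, ι, hE, hEu, -, hι⟩ := h.hulls T₁ inferInstance
  have hart := h.artinian
  induction N generalizing X with
  | zero =>
    have : Subsingleton X := by
      rw [← Module.length_eq_zero_iff (R := A)]
      simpa using hN
    exact ⟨0, LinearMap.ext fun x => Subsingleton.elim _ _⟩
  | succ N ih =>
    rcases eq_top_or_exists_le_coatom (⊥ : Submodule A X) with hb | ⟨K, hK, -⟩
    · have : Subsingleton X := by
        rw [← Submodule.subsingleton_iff A]
        exact subsingleton_of_bot_eq_top hb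
      exact ⟨0, LinearMap.ext fun x => Subsingleton.elim _ _⟩
    obtain ⟨k, c, hc⟩ := h.exists_surjective hX hK
    obtain ⟨_, _⟩ := h.isNoetherian_isArtinian k
    have hk := h.isSimple k
    have := (h.cover k).1
    -- X splits as `P k` ⊕ `ker c`. The component in `P k` is not onto and factors by the uniserial
    -- case; the other is handled by induction on length.
    obtain ⟨u, hu⟩ := Module.projective_lifting_property c LinearMap.id hc
    have hcu : ∀ y, c (u y) = y := fun y => LinearMap.congr_fun hu y
    let π : X →ₗ[A] LinearMap.ker c := (LinearMap.id - u ∘ₗ c).codRestrict _ fun x => by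
      simp [hcu]
    have hπ : ∀ x, (π x : X) = x - u (c x) := fun x => rfl
    have hproj : Module.Projective A (LinearMap.ker c) :=
      Module.Projective.of_split (LinearMap.ker c).subtype π (by
        ext x
        simp [hπ])
    have hlen : Module.length A (LinearMap.ker c) ≤ N := by
      have h1 := Module.length_eq_add_of_exact (LinearMap.ker c).subtype c
        (Submodule.subtype_injective _) hc (LinearMap.exact_subtype_ker_map c)
      have h2 : (1 : ℕ∞) ≤ Module.length A (P k) := by
        rw [← h.coe_projectiveLength]
        exact_mod_cast h.one_le_projectiveLength k
      have h3 : Module.length A (LinearMap.ker c) + 1 ≤ N + 1 := by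
        calc _ ≤ Module.length A (LinearMap.ker c) + Module.length A (P k) := by gcongr
          _ ≤ N + 1 := by rw [← h1]; exact_mod_cast hN
      exact (ENat.add_le_add_iff_right (by simp)).1 h3
    obtain ⟨θ₁, hθ₁⟩ := hp₀.exists_comp_eq_of_range_ne_top hq hE hEu hι hf hf0 (h.isUniserial k)
      (c ∘ₗ g) (fun h0 => hg k c (LinearMap.range_eq_top.1 h0))
    obtain ⟨θ₂, hθ₂⟩ := ih hproj inferInstance hlen (π ∘ₗ g) fun k' c' => by
      rw [← LinearMap.comp_assoc]
      exact hg k' (c' ∘ₗ π)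
    refine ⟨u ∘ₗ θ₁ + (LinearMap.ker c).subtype ∘ₗ θ₂, ?_⟩
    ext x
    have e1 : θ₁ (f x) = c (g x) := LinearMap.congr_fun hθ₁ x
    have e2 : θ₂ (f x) = π (g x) := LinearMap.congr_fun hθ₂ x
    simp [e1, e2, hπ]

/-- Some composite P₁ → A → P k is onto, hence split; the splitting w is onto because P₁ is local,
so `w ∘ c` inverts g on the left. -/
theorem exists_leftInverse (h : IsNakayamaFamily p) (hp₀ : IsProjectiveCover p₀)
    (hq : IsProjectiveCover q) (hf : LinearMap.range f = LinearMap.ker p₀) (hf0 : f ≠ 0)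
    {g : P₁ →ₗ[A] A} (hg : ∀ θ : P₀ →ₗ[A] A, θ ∘ₗ f ≠ g) :
    ∃ d : A →ₗ[A] P₁, d ∘ₗ g = LinearMap.id := by
  have hart := h.artinian
  obtain ⟨k, c, hc⟩ : ∃ k, ∃ c : A →ₗ[A] P k, Function.Surjective (c ∘ₗ g) := by
    by_contra! hno
    have hl : Module.length A A ≠ ⊤ := Module.length_ne_top
    obtain ⟨θ, hθ⟩ := h.exists_comp_eq_of_forall hp₀ hq hf hf0 (Module.length A A).toNat
      inferInstance inferInstance (ENat.natCast_toNat hl).ge g hno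
    exact hg θ hθ
  have hk := h.isSimple k
  have := (h.cover k).1
  obtain ⟨w, hw⟩ := Module.projective_lifting_property (c ∘ₗ g) LinearMap.id hc
  have hws : Function.Surjective w := by
    refine hq.surjective_of_range_comp (c := c ∘ₗ g) (fun h0 => (h.cover k).ne_zero ?_) ?_
    · rw [← LinearMap.comp_id (p k), ← hw, h0, LinearMap.zero_comp, LinearMap.comp_zero]
    · rw [hw, LinearMap.range_id]
      exact le_top
  refine ⟨w ∘ₗ c, LinearMap.ext fun x => ?_⟩
  obtain ⟨y, rfl⟩ := hws x
  exact congrArg w (LinearMap.congr_fun hw y)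

/-- If g represents a nonzero class and d is a left inverse of g, then every g' equals g followed by
right multiplication by g' (d 1), so this class generates. The quotient is nonzero because a section
of A → P₁ factoring through f would split f, against the superfluity of the radical. -/
theorem isSimpleModule_transposeOf (h : IsNakayamaFamily p) (hp₀ : IsProjectiveCover p₀)
    (hq : IsProjectiveCover q) (hf : LinearMap.range f = LinearMap.ker p₀) (hf0 : f ≠ 0) :
    IsSimpleModule Aᵐᵒᵖ (TransposeOf f) := by
  rw [isSimpleModule_iff_toSpanSingleton_surjective]
  constructor
  · obtain ⟨x, hx⟩ := hq.exists_span_eq_top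
    have hs : Function.Surjective (LinearMap.toSpanSingleton A P₁ x) := by
      rw [← LinearMap.range_eq_top, LinearMap.range_toSpanSingleton, hx]
    have := hq.1
    obtain ⟨s, hs⟩ := Module.projective_lifting_property _ LinearMap.id hs
    refine ⟨Submodule.Quotient.mk s, 0, fun h0 => ?_⟩
    rw [Submodule.Quotient.mk_eq_zero] at h0
    obtain ⟨θ, hθ⟩ := h0
    have hθ' : θ ∘ₗ f = s := hθ
    set r : P₀ →ₗ[A] P₁ := LinearMap.toSpanSingleton A P₁ x ∘ₗ θ with hr
    have hrf : r ∘ₗ f = LinearMap.id := by rw [hr, LinearMap.comp_assoc, hθ', hs]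
    have hker : LinearMap.ker r = ⊤ := by
      refine hp₀.2.2 _ (eq_top_iff.2 fun y _ => ?_)
      have h1 : f (r y) ∈ LinearMap.ker p₀ := hf ▸ LinearMap.mem_range_self f _
      have h2 : y - f (r y) ∈ LinearMap.ker r := by
        rw [LinearMap.mem_ker, map_sub, sub_eq_zero]
        exact (LinearMap.congr_fun hrf (r y)).symm
      have := Submodule.add_mem_sup h2 h1
      rwa [sub_add_cancel] at this
    refine hq.ne_zero ?_
    rw [← LinearMap.comp_id q, ← hrf, LinearMap.ker_eq_top.1 hker, LinearMap.zero_comp,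
      LinearMap.comp_zero]
  · intro m hm y
    obtain ⟨g, rfl⟩ := Submodule.Quotient.mk_surjective _ m
    obtain ⟨g', rfl⟩ := Submodule.Quotient.mk_surjective _ y
    obtain ⟨d, hd⟩ := h.exists_leftInverse hp₀ hq hf hf0 (g := g) fun θ hθ => hm (by
      rw [Submodule.Quotient.mk_eq_zero]
      exact ⟨θ, hθ⟩)
    refine ⟨MulOpposite.op (g' (d 1)), ?_⟩
    rw [LinearMap.toSpanSingleton_apply, ← Submodule.Quotient.mk_smul]
    congr 1
    ext x
    have h1 : d (g x) = x := LinearMap.congr_fun hd x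
    have h2 : g' (d (g x)) = g x * g' (d 1) := by
      rw [← smul_eq_mul, ← map_smul, ← map_smul, smul_eq_mul, mul_one]
    rw [h1] at h2
    rw [h2]
    rfl

variable {R : Type u} [CommRing R] [Algebra R A]

theorem finite_hom [IsNoetherianRing R] [Module.Finite R A] (hq : IsProjectiveCover q) :
    Module.Finite R (P₁ →ₗ[A] A) := by
  obtain ⟨x, hx⟩ := hq.exists_span_eq_top
  let ev : (P₁ →ₗ[A] A) →ₗ[R] A :=
    { toFun := fun g => g x, map_add' := fun _ _ => rfl, map_smul' := fun _ _ => rfl }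
  have hev : Function.Injective ev := by
    intro g g' hgg'
    ext y
    obtain ⟨a, rfl⟩ := Submodule.mem_span_singleton.1 (hx ▸ Submodule.mem_top : y ∈ A ∙ x)
    rw [map_smul, map_smul]
    exact congrArg (a • ·) hgg'
  exact Module.Finite.of_injective ev hev

theorem finite_transposeOf [IsNoetherianRing R] [Module.Finite R A] (hq : IsProjectiveCover q) :
    Module.Finite R (TransposeOf f) := by
  have := finite_hom (R := R) hq
  let π : (P₁ →ₗ[A] A) →ₗ[R] TransposeOf f :=
    { toFun := Submodule.Quotient.mk
      map_add' := fun _ _ => rfl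
      map_smul' := fun _ _ => rfl }
  exact Module.Finite.of_surjective π (Submodule.Quotient.mk_surjective _)

/-- D Tr is simple, so it suffices to map P₁ to it nontrivially: send y to `g y • φ` with φ nonzero
on the class of g. With s a section of A → P₁, 1 ↦ x, the value of `g x • φ` at the class of s is
φ(g), since s(y) x = y. -/
theorem nonempty_equiv_artinDual (h : IsNakayamaFamily p) [IsArtinianRing R] [Module.Finite R A]
    (hp₀ : IsProjectiveCover p₀) (hq : IsProjectiveCover q)
    (hf : LinearMap.range f = LinearMap.ker p₀) (hf0 : f ≠ 0) :
    Nonempty (T₁ ≃ₗ[A] ArtinDual R A (TransposeOf f)) := by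
  have := h.isSimpleModule_transposeOf hp₀ hq hf hf0
  have : Module.Finite R (TransposeOf f) := finite_transposeOf hq
  have hD : IsSimpleModule A (ArtinDual R A (TransposeOf f)) := ArtinDual.isSimpleModule
  have := IsSimpleModule.nontrivial A (ArtinDual R A (TransposeOf f))
  obtain ⟨φ, hφ⟩ := exists_ne (0 : ArtinDual R A (TransposeOf f))
  obtain ⟨y, hy⟩ : ∃ y, ArtinDual.toHom φ y ≠ 0 := by
    by_contra! h0
    exact hφ (LinearMap.ext h0)
  obtain ⟨g, rfl⟩ := Submodule.Quotient.mk_surjective _ y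
  obtain ⟨x, hx⟩ := hq.exists_span_eq_top
  have hs : Function.Surjective (LinearMap.toSpanSingleton A P₁ x) := by
    rw [← LinearMap.range_eq_top, LinearMap.range_toSpanSingleton, hx]
  have := hq.1
  obtain ⟨s, hs⟩ := Module.projective_lifting_property _ LinearMap.id hs
  refine hq.nonempty_equiv (f := LinearMap.toSpanSingleton A _ φ ∘ₗ g) fun h0 => hy ?_
  have h1 : g x • φ = 0 := LinearMap.congr_fun h0 x
  have h2 : MulOpposite.op (g x) • s = g := by
    ext y
    have h3 : s y • x = y := LinearMap.congr_fun hs y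
    calc s y * g x = g (s y • x) := by rw [map_smul, smul_eq_mul]
      _ = g y := by rw [h3]
  calc ArtinDual.toHom φ (Submodule.Quotient.mk g)
      = ArtinDual.toHom (g x • φ) (Submodule.Quotient.mk s) := by
        rw [ArtinDual.toHom_smul, ← Submodule.Quotient.mk_smul, h2]
    _ = 0 := by rw [h1]; rfl

end Presentation

/-- The Auslander–Reiten translate of a non-projective simple module is the top of the radical of
its projective cover. -/
theorem exists_radicalArrow_of_isMinimalPresentation (h : IsNakayamaFamily p) (R : Type u)
    [CommRing R] [Algebra R A] [IsArtinianRing R] [Module.Finite R A]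
    {P₁ P₀ T : Type u} [AddCommGroup P₁] [Module A P₁] [AddCommGroup P₀] [Module A P₀]
    [AddCommGroup T] [Module A T] {f : P₁ →ₗ[A] P₀} {p₀ : P₀ →ₗ[A] T}
    (hfp : IsMinimalPresentation f p₀) {m : Fin n} (e : T ≃ₗ[A] S m)
    (hT : ¬ Module.Projective A T) :
    ∃ j, RadicalArrow p m j ∧ Nonempty (S j ≃ₗ[A] ArtinDual R A (TransposeOf f)) := by
  obtain ⟨hp₀, hfker, hf'⟩ := hfp
  have hart := h.artinian
  have hm := h.isSimple m
  have hTs : IsSimpleModule A T := IsSimpleModule.congr e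
  have hker : LinearMap.ker p₀ ≠ ⊥ := fun h0 => hT (hp₀.projective_iff.2 h0)
  have hu := hp₀.isUniserial h.nakayama
  have := hp₀.finite
  set f' := f.codRestrict (LinearMap.ker p₀) hfker with hf'def
  have hrange : LinearMap.range f = LinearMap.ker p₀ := by
    refine le_antisymm (by rintro _ ⟨x, rfl⟩; exact hfker x) fun x hx => ?_
    obtain ⟨y, hy⟩ := hf'.2.1 ⟨x, hx⟩
    exact ⟨y, congrArg Subtype.val hy⟩
  have hf0 : f ≠ 0 := fun h0 => hker (by rw [← hrange, h0, LinearMap.range_zero])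
  have hnt : Nontrivial (LinearMap.ker p₀) := Submodule.nontrivial_iff_ne_bot.2 hker
  obtain ⟨K, hK, -⟩ := (eq_top_or_exists_le_coatom
    (⊥ : Submodule A (LinearMap.ker p₀))).resolve_left bot_ne_top
  have hs : IsSimpleModule A (LinearMap.ker p₀ ⧸ K) := isSimpleModule_iff_isCoatom.2 hK
  -- The kernel of `p₀` is uniserial, so its maximal submodule K is superfluous and P₁ also covers
  -- the simple top.
  have hq : IsProjectiveCover (K.mkQ ∘ₗ f') := by
    refine ⟨hf'.1, K.mkQ_surjective.comp hf'.2.1, fun N hN => hf'.2.2 N ?_⟩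
    have h1 : N.map f' ⊔ K = ⊤ := by
      rw [eq_top_iff]
      intro x _
      obtain ⟨y, rfl⟩ := hf'.2.1 x
      obtain ⟨a, ha, b, hb, rfl⟩ := Submodule.mem_sup.1 (hN ▸ Submodule.mem_top : y ∈ N ⊔ _)
      rw [map_add]
      refine Submodule.add_mem_sup (Submodule.mem_map_of_mem ha) ?_
      simpa using hb
    have h2 : N.map f' = ⊤ := by
      rcases hu ((N.map f').map (LinearMap.ker p₀).subtype) (K.map (LinearMap.ker p₀).subtype)
        with h3 | h3
      · have h4 := (Submodule.map_le_map_iff_of_injective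
          (Submodule.subtype_injective _) _ _).1 h3
        rw [sup_eq_right.2 h4] at h1
        exact absurd h1 hK.1
      · have h4 := (Submodule.map_le_map_iff_of_injective
          (Submodule.subtype_injective _) _ _).1 h3
        rwa [sup_eq_left.2 h4] at h1
    rw [← Submodule.comap_map_eq, h2, Submodule.comap_top]
  obtain ⟨e₁⟩ := h.nonempty_equiv_artinDual (R := R) hp₀ hq hrange hf0
  obtain ⟨j, ⟨e₂⟩⟩ := h.complete.2.2 _ hs
  refine ⟨j, ⟨fun h0 => hT ?_, ?_⟩, ⟨e₂.symm ≪≫ₗ e₁⟩⟩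
  · have := ((h.cover m).projective_iff).2 h0
    exact Module.Projective.of_equiv e.symm
  · have hj := h.isSimple j
    obtain ⟨θ, hθ⟩ := (h.cover j).1.exists_comp_eq (K.mkQ ∘ₗ f') (e₂.symm.toLinearMap ∘ₗ p j) (by
      rw [LinearMap.range_eq_top.2 hq.2.1]
      exact le_top)
    have hθs : Function.Surjective θ := hq.surjective_of_comp_ne_zero (by
      rw [hθ]
      exact (h.cover j).comp_ne_zero e₂.symm.injective)
    obtain ⟨η, hη⟩ := hp₀.1.exists_comp_eq (p m) (e.toLinearMap ∘ₗ p₀) (by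
      rw [LinearMap.range_eq_top.2 (h.cover m).2.1]
      exact le_top)
    have hηs : Function.Surjective η := (h.cover m).surjective_of_comp_ne_zero (by
      rw [hη]
      exact hp₀.comp_ne_zero e.injective)
    refine ⟨η ∘ₗ f ∘ₗ θ, ?_⟩
    rw [LinearMap.range_comp, LinearMap.range_comp_of_range_eq_top _ (LinearMap.range_eq_top.2 hθs),
      hrange]
    have hη' : ∀ y, p m (η y) = e (p₀ y) := fun y => LinearMap.congr_fun hη y
    apply le_antisymm
    · rintro _ ⟨y, hy, rfl⟩
      rw [LinearMap.mem_ker, hη', show p₀ y = 0 from hy, map_zero]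
    · intro x hx
      obtain ⟨y, rfl⟩ := hηs x
      refine ⟨y, ?_, rfl⟩
      rw [LinearMap.mem_ker, hη'] at hx
      exact e.injective (hx.trans (map_zero e).symm)

theorem exists_isMinimalPresentation (h : IsNakayamaFamily p) {m j : Fin n}
    (hmj : RadicalArrow p m j) {T : Type u} [AddCommGroup T] [Module A T] (e : S m ≃ₗ[A] T) :
    ∃ f : P j →ₗ[A] P m, IsMinimalPresentation f (e.toLinearMap ∘ₗ p m) := by
  obtain ⟨hm, f, hf⟩ := hmj
  have hj := h.isSimple j
  have hker : LinearMap.ker (e.toLinearMap ∘ₗ p m) = LinearMap.ker (p m) := LinearEquiv.ker_comp _ _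
  have hmem : ∀ x, f x ∈ LinearMap.ker (e.toLinearMap ∘ₗ p m) := fun x => by
    rw [hker, ← hf]
    exact ⟨x, rfl⟩
  refine ⟨f, (h.cover m).comp_equiv e, hmem, (h.cover j).1, ?_, fun N hN => ?_⟩
  · rintro ⟨y, hy⟩
    rw [hker, ← hf] at hy
    obtain ⟨x, rfl⟩ := hy
    exact ⟨x, rfl⟩
  · by_contra hN'
    rw [LinearMap.ker_codRestrict] at hN
    have hf0 : LinearMap.ker f ≠ ⊤ := fun h0 => hm (by
      rw [← hf, LinearMap.ker_eq_top.1 h0, LinearMap.range_zero])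
    exact (h.cover j).isCoatom_ker.1 (top_le_iff.1
      (hN ▸ sup_le ((h.cover j).le_ker hN') ((h.cover j).le_ker hf0)))

/-- The socle of `P i` is `S m` with m = σ^(L i - 1) i, so f(i) = σ m. If `S m` is not projective,
its translate is `S (σ m)`. Otherwise m is the only vertex without an outgoing arrow, so σ m is the
only one without an incoming arrow, that is, the only injective one. -/
theorem resolutionArrow_iff (h : IsNakayamaFamily p) (R : Type u) [CommRing R] [Algebra R A]
    [IsArtinianRing R] [Module.Finite R A] {σ : Equiv.Perm (Fin n)}
    (hσ : ∀ i j, RadicalArrow p i j → j = σ i)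
    (huniq : ∀ i i', LinearMap.ker (p i) = ⊥ → LinearMap.ker (p i') = ⊥ → i = i') (i j : Fin n) :
    ResolutionArrow R A S P i j ↔ j = kupischMap σ (projectiveLength A P) i := by
  obtain ⟨e⟩ := h.nonempty_socle_equiv hσ i
  have hpos := h.one_le_projectiveLength i
  have hmap : kupischMap σ (projectiveLength A P) i =
      σ ((σ ^ (projectiveLength A P i - 1)) i) := by
    rw [← Equiv.Perm.mul_apply, ← pow_succ', Nat.sub_add_cancel hpos, kupischMap]
  rw [hmap]
  set m := (σ ^ (projectiveLength A P i - 1)) i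
  have hm := h.isSimple m
  have hproj : Module.Projective A (socle A (P i)) ↔ LinearMap.ker (p m) = ⊥ := by
    rw [← (h.cover m).projective_iff]
    exact ⟨fun _ => Module.Projective.of_equiv e.symm, fun _ => Module.Projective.of_equiv e⟩
  constructor
  · rintro (⟨hnp, P₁, P₀, _, _, _, _, f, p₀, hfp, ⟨e'⟩⟩ | ⟨hp, hs, hinj⟩)
    · obtain ⟨j', hj', ⟨e''⟩⟩ := h.exists_radicalArrow_of_isMinimalPresentation R hfp e.symm hnp
      rw [← hσ _ _ hj']
      exact h.complete.2.1 _ _ ⟨e' ≪≫ₗ e''.symm⟩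
    · rw [hproj] at hp
      rw [h.injective_iff] at hinj
      have h1 : LinearMap.ker (p (σ.symm j)) = ⊥ := by
        by_contra hne
        obtain ⟨j', hj'⟩ := h.exists_radicalArrow hne
        have := hσ _ _ hj'
        rw [Equiv.apply_symm_apply] at this
        exact hinj _ (this ▸ hj')
      rw [huniq m _ hp h1, Equiv.apply_symm_apply]
  · rintro rfl
    by_cases hker : LinearMap.ker (p m) = ⊥
    · refine Or.inr ⟨hproj.2 hker, h.isSimple _, (h.injective_iff _).2 fun i' hi' => hi'.1 ?_⟩
      rwa [← σ.injective (hσ _ _ hi')]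
    · have hnp : ¬ Module.Projective A (socle A (P i)) := fun h0 => hker (hproj.1 h0)
      obtain ⟨j', hj'⟩ := h.exists_radicalArrow hker
      obtain rfl := hσ _ _ hj'
      obtain ⟨f, hf⟩ := h.exists_isMinimalPresentation hj' e
      obtain ⟨j'', hj'', e'⟩ := h.exists_radicalArrow_of_isMinimalPresentation R hf e.symm hnp
      obtain rfl := hσ _ _ hj''
      exact Or.inl ⟨hnp, _, _, _, _, _, _, f, _, hf, e'⟩

end IsNakayamaFamily

end Family

theorem mainTheorem5 (R A : Type u) [CommRing R] [IsArtinianRing R] [Ring A] [Algebra R A]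
    [Module.Finite R A] (hconn : IsConnectedRing A) (hNak : IsNakayama A)
    (n : ℕ) (S P : Fin n → Type u)
    [∀ i, AddCommGroup (S i)] [∀ i, Module A (S i)]
    [∀ i, AddCommGroup (P i)] [∀ i, Module A (P i)]
    (hS : IsCompleteSimpleFamily A S)
    (p : ∀ i, P i →ₗ[A] S i) (hp : ∀ i, IsProjectiveCover (p i)) :
    (blackCycleNumber R A S P ≠ 0 ↔
      (Matrix.fromRows (cartanMatrix A S P).transpose (cartanMatrix A S P)).rank =
        (Matrix.fromBlocks (cartanMatrix A S P).transpose (Matrix.of fun _ (_ : Unit) => 1)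
          (cartanMatrix A S P) (Matrix.of fun _ (_ : Unit) => 1)).rank) ∧
    (blackCycleNumber R A S P ≠ 0 →
      (blackCycleNumber R A S P : ℤ) = (n : ℤ) + 1 -
        ((Matrix.fromCols (cartanMatrix A S P) (cartanMatrix A S P).transpose).rank : ℤ)) := by
  have h : IsNakayamaFamily p :=
    ⟨isArtinian_of_tower R inferInstance, hNak, hNak.hasUniserialHulls R, hS, hp⟩
  obtain ⟨σ, hσ, htr, huniq⟩ := h.exists_perm hconn
  have hK := h.isKupisch hσ htr
  -- For n = 0 the system C x = Cᵀ x = 1 would be solvable with no black cycle; a nontrivial A has a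
  -- simple module.
  have hne : Nonempty (Fin n) := by
    have := hconn.1
    obtain ⟨K, hK⟩ := Ideal.exists_maximal A
    obtain ⟨i, -⟩ := hS.2.2 (A ⧸ K) (isSimpleModule_iff_isCoatom.2 hK.out)
    exact ⟨i⟩
  have hb : blackCycleNumber R A S P =
      (IsKupisch.blackCycles σ (projectiveLength A P)).ncard := by
    have harrow : ResolutionArrow R A S P =
        fun i j => j = kupischMap σ (projectiveLength A P) i := by
      ext i j
      exact h.resolutionArrow_iff R hσ huniq i j
    rw [blackCycleNumber, IsKupisch.blackCycles, harrow]
    congr 1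
    ext C
    refine and_congr_right fun _ => forall₂_congr fun i _ => ?_
    rw [ne_eq, h.projectiveDimension_eq_one_iff hσ]
    -- Since L i ≤ L (σ i) + 1 always holds, excluding equality is the same as L i ≤ L (σ i).
    have := h.projectiveLength_le hσ i
    omega
  have := hK.rank_statement (cartanMatrix A S P) (h.cartanMatrix_eq hσ) _ hb
  rwa [Fintype.card_fin] at this
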